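/- Let $d\ge 3$, let $\|\cdot\|$ be a norm on $\mathbb R^d$, let $\|\cdot\|_{\max}$ be the maximum norm, and let $q>\frac d{d-1}$. For a probability measure $\mu$ on $\mathbb R^d$ and $N\in\mathbb N$ put $$V^{\mathrm{rand}}_{N,1}(\mu)=\mathbb E\bigl[\rho_1(\mu,\hat\mu_N)\bigr]\in[0,\infty],\qquad \rho_1(\mu,\nu)=\inf_{\xi}\int\|x-y\|\,\xi(dx,dy),$$ where $\hat\mu_N=\frac1N\sum_{j=1}^N\delta_{X_j}$ is the empirical measure of $N$ independent $\mu$-distributed random variables and the infimum is over all measures $\xi$ on $\mathbb R^d\times\mathbb R^d$ with marginals $\mu$ and $\nu$. Let $\kappa=\kappa^{\mathrm{Pierce}}_{1,q}$ be the smallest constant such that $$V^{\mathrm{rand}}_{N,1}(\mu)\le\kappa\Bigl(\int\|x\|_{\max}^q\,d\mu(x)\Bigr)^{1/q}N^{-1/d}\qquad\text{for all probability measures }\mu\text{ on }\mathbb R^d\text{ and all }N\ge1 .$$ Then $\kappa$ exists and is finite. If $q>2$, then moreover $$\kappa\le \frac{2^{q/2}\,\mathfrak d}{1-2^{1-q/2}}+\frac{2^{1+q(1-1/d)}\,\kappa^{\mathrm{cube}}}{1-2^{1-q(1-1/d)}},\qquad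 \kappa^{\mathrm{cube}}=\mathfrak d\,2^{(d-2)/2}\Bigl[\frac1{1-2^{1-d/2}}+\frac1{1-2^{-1}}\Bigr],$$ where $\mathfrak d=\sup_{x,y\in[0,1)^d}\|x-y\|$. For all probability measures $\mu,\nu$ on $\mathbb R^d$, writing $|\mu-\nu|$ for the total variation measure of the signed measure $\mu-\nu$ and $\|\mu-\nu\|=|\mu-\nu|(\mathbb R^d)$, one has $$\limsup_{N\to\infty}N^{1/d}\bigl|V^{\mathrm{rand}}_{N,1}(\mu)-V^{\mathrm{rand}}_{N,1}(\nu)\bigr|\le 2\,\kappa\,\|\mu-\nu\|^{1-\frac1d-\frac1q}\Bigl(\int\|x\|_{\max}^q\,|\mu-\nu|(dx)\Bigr)^{1/q}.$$ Consequently the asymptotic error constants depend continuously on $\mu$ in total variation, in a moment-weighted sense: the numbers $$\Bigl|\limsup_{N\to\infty}N^{1/d}V^{\mathrm{rand}}_{N,1}(\mu)-\limsup_{N\to\infty}N^{1/d}V^{\mathrm{rand}}_{N,1}(\nu)\Bigr|\quad\text{and}\quad\Bigl|\liminf_{N\to\infty}N^{1/d}V^{\mathrm{rand}}_{N,1}(\mu)-\liminf_{N\to\infty}N^{1/d}V^{\mathrm{rand}}_{N,1}(\nu)\Bigr|$$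 are bounded by the same right-hand side. (Differences are taken in $[0,\infty]$ with $|\infty-\infty|=0$, and $0\cdot\infty=0$ on the right.) -/

import Mathlib

open MeasureTheory Filter
open scoped ENNReal

noncomputable section

namespace RandomQuantization

/-- The transports from `μ` to `ν`: measures on the product space with marginals `μ` and `ν`. -/
def couplings {d : ℕ} (μ ν : Measure (Fin d → ℝ)) : Set (Measure ((Fin d → ℝ) × (Fin d → ℝ))) :=
  {ξ | ξ.map Prod.fst = μ ∧ ξ.map Prod.snd = ν}

/-- The `p`-th Wasserstein distance of `μ` and `ν`, with respect to the (semi)norm `nrm`,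
with values in `[0, ∞]`. -/
def wasserstein {d : ℕ} (nrm : Seminorm ℝ (Fin d → ℝ)) (p : ℝ) (μ ν : Measure (Fin d → ℝ)) :
    ℝ≥0∞ :=
  ⨅ ξ ∈ couplings μ ν, (∫⁻ z, ENNReal.ofReal (nrm (z.1 - z.2)) ^ p ∂ξ) ^ (1 / p)

/-- The empirical measure of the points `x 0, …, x (N - 1)`. -/
def empirical {d N : ℕ} (x : Fin N → (Fin d → ℝ)) : Measure (Fin d → ℝ) :=
  (N : ℝ≥0∞)⁻¹ • ∑ i, Measure.dirac (x i)

/-- The random quantization error `E[ρ_p^p(μ, μ̂_N)]^{1/p}`, where `μ̂_N` is the empirical measure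
of `N` independent `μ`-distributed points (realised on the product space). -/
def randError {d : ℕ} (nrm : Seminorm ℝ (Fin d → ℝ)) (p : ℝ) (N : ℕ) (μ : Measure (Fin d → ℝ)) :
    ℝ≥0∞ :=
  (∫⁻ x, wasserstein nrm p μ (empirical x) ^ p ∂(Measure.pi fun _ : Fin N => μ)) ^ (1 / p)

/-- The `q`-th absolute moment of `m` with respect to the maximum norm (which is the norm that
`Fin d → ℝ` carries). -/
def maxMoment {d : ℕ} (q : ℝ) (m : Measure (Fin d → ℝ)) : ℝ≥0∞ :=
  ∫⁻ x, ENNReal.ofReal ‖x‖ ^ q ∂m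

/-- `κ` is an admissible constant in the Pierce type estimate with exponents `p` and `q`. -/
def IsPierceConst {d : ℕ} (nrm : Seminorm ℝ (Fin d → ℝ)) (p q : ℝ) (κ : ℝ≥0∞) : Prop :=
  ∀ μ : Measure (Fin d → ℝ), IsProbabilityMeasure μ → ∀ N : ℕ, 1 ≤ N →
    randError nrm p N μ ≤ κ * maxMoment q μ ^ (1 / q) * (N : ℝ≥0∞) ^ (-(1 / (d : ℝ)))

/-- The best constant in the Pierce type estimate. -/
def pierceConst {d : ℕ} (nrm : Seminorm ℝ (Fin d → ℝ)) (p q : ℝ) : ℝ≥0∞ :=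
  sInf {κ | IsPierceConst nrm p q κ}

/-- The diameter of the cube `[0,1)^d` with respect to `nrm`. -/
def cubeDiam {d : ℕ} (nrm : Seminorm ℝ (Fin d → ℝ)) : ℝ :=
  sSup {r | ∃ x y : Fin d → ℝ, (∀ i, x i ∈ Set.Ico (0 : ℝ) 1) ∧ (∀ i, y i ∈ Set.Ico (0 : ℝ) 1) ∧
    r = nrm (x - y)}

/-- The explicit constant for measures on the cube `[0,1)^d`. -/
def explicitCubeConst {d : ℕ} (nrm : Seminorm ℝ (Fin d → ℝ)) (p : ℝ) : ℝ :=
  cubeDiam nrm * 2 ^ (((d : ℝ) - 2) / (2 * p)) *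
    (1 / (1 - 2 ^ (p - (d : ℝ) / 2)) + 1 / (1 - 2 ^ (-p))) ^ (1 / p)

/-- The explicit constant for the Pierce type estimate (meaningful for `2 * p < q`). -/
def explicitPierceConst {d : ℕ} (nrm : Seminorm ℝ (Fin d → ℝ)) (p q : ℝ) : ℝ :=
  (2 ^ (p - 1) * 2 ^ (q / 2) * cubeDiam nrm ^ p / (1 - 2 ^ (p - q / 2)) +
    2 ^ (p + q * (1 - p / (d : ℝ))) * explicitCubeConst nrm p ^ p /
      (1 - 2 ^ (-(q * (1 - p / (d : ℝ))) + p))) ^ (1 / p)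

/-- The total variation measure `|μ - ν|` of the signed measure `μ - ν`. -/
def absSub {d : ℕ} (μ ν : Measure (Fin d → ℝ)) [IsFiniteMeasure μ] [IsFiniteMeasure ν] :
    Measure (Fin d → ℝ) :=
  (μ.toSignedMeasure - ν.toSignedMeasure).totalVariation

/-- `|a - b|` for `a, b ∈ [0, ∞]`, with `|∞ - ∞| = 0` and `|∞ - b| = |b - ∞| = ∞` for finite `b`. -/
def absDiff (a b : ℝ≥0∞) : ℝ≥0∞ := max (a - b) (b - a)

/-- The bound `2 κ ‖μ - ν‖^{1 - 1/d - 1/q} (∫ ‖x‖_max^q d|μ - ν|)^{1/q}`, with `κ` the best constant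
in the Pierce type estimate with exponents `1` and `q`. -/
def tvBound {d : ℕ} (nrm : Seminorm ℝ (Fin d → ℝ)) (q : ℝ) (μ ν : Measure (Fin d → ℝ))
    [IsFiniteMeasure μ] [IsFiniteMeasure ν] : ℝ≥0∞ :=
  2 * pierceConst nrm 1 q * absSub μ ν Set.univ ^ (1 - 1 / (d : ℝ) - 1 / q) *
    maxMoment q (absSub μ ν) ^ (1 / q)

/-- `N^{1/d}` times the random quantization error with `p = 1`. -/
def scaledError {d : ℕ} (nrm : Seminorm ℝ (Fin d → ℝ)) (μ : Measure (Fin d → ℝ)) (N : ℕ) : ℝ≥0∞ :=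
  (N : ℝ≥0∞) ^ (1 / (d : ℝ)) * randError nrm 1 N μ

end RandomQuantization

end

/-! The proof rests on a cancellation property special to exponent 1: adding the same finite measure
`c` to two finite measures of equal mass and finite first moment does not lower their transport cost
(`transportCost_le_transportCost_add`). It is obtained from couplings, without duality: `c` is
scaled down by a large factor, the part of a coupling that leads from `a` to `b` is cut out, and the
small remainder is sent through the origin.

Pierce constant. Space is split into dyadic shells, and the box of radius `M * 2 ^ n` around shell
`n` is subdivided dyadically. At generation 0 every centre is the origin, so both measures collapse
to the same point mass. By cancellation, refining by one generation adds only the displacement of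
the centres, integrated against the absolute difference of the two discretised measures. For an
empirical measure the mean discrepancy of a cube `C` is at most the standard deviation, hence at
most the square root of `μ C / N`, and Cauchy–Schwarz over the cubes of one generation gives terms
growing like `2 ^ (k * (d / 2 - 1))`. For `d ≥ 3` the finest generation dominates. Stopping when the
number of cubes is about `N * p`, where `p` is the mass of the shell, leaves a contribution of order
`2 ^ n * M * p ^ (1 - 1 / d) * N ^ (-1 / d)` (`shell_contribution_le`). Markov's inequality bounds
`p` by a multiple of `2 ^ (-q * n)`, and the shells sum up precisely because `q > d / (d - 1)`.

Continuity. With `t` the mass of `μ - ν`, one has `μ = (1 - t) m + t π₁` and `ν = (1 - t) m + t π₂`.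
Both samples are drawn with the same coin flips and the same points of `m`, so they differ only at
the selected indices. Cancellation (`transportCost_empirical_le_of_agree`) bounds the difference of
the costs by the cost of approximating `π₁` and `π₂` by their selected points, plus the deviation of
the selected fraction from `t` times the distance of `π₁` and `π₂`. The Pierce estimate,
conditionally on the selection, followed by Jensen's inequality, turns the first part into the
asserted bound (`randError_mixture_le`). The second part is of order `N ^ (-1 / 2)`, which is
negligible against `N ^ (-1 / d)` when `d ≥ 3`. -/

noncomputable section

namespace RandomQuantization

open ProbabilityTheory Topology

/-! ### Transport cost for exponent 1: triangle inequality and cancellation. -/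

section TransportCost

variable {d : ℕ} (nrm : Seminorm ℝ (Fin d → ℝ))

/-- The transport cost `inf ∫ nrm (x - y) dξ` over all transports `ξ` from `a` to `b`. -/
def transportCost (a b : Measure (Fin d → ℝ)) : ℝ≥0∞ :=
  ⨅ ξ ∈ couplings a b, ∫⁻ z, ENNReal.ofReal (nrm (z.1 - z.2)) ∂ξ

lemma wasserstein_one (a b : Measure (Fin d → ℝ)) :
    wasserstein nrm 1 a b = transportCost nrm a b := by
  simp [wasserstein, transportCost]

lemma randError_one (N : ℕ) (μ : Measure (Fin d → ℝ)) :
    randError nrm 1 N μ =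
      ∫⁻ x, transportCost nrm μ (empirical x) ∂(Measure.pi fun _ : Fin N => μ) := by
  simp [randError, wasserstein_one]

lemma seminorm_continuous : Continuous nrm := by
  have h : ∀ x, nrm x ≤ ∑ i, |x i| * nrm (Pi.single i 1) := by
    intro x
    have hx : x = ∑ i, x i • (Pi.single i (1 : ℝ) : Fin d → ℝ) := by
      simp only [← Pi.single_smul, smul_eq_mul, mul_one]
      exact (Finset.univ_sum_single x).symm
    calc nrm x = nrm (∑ i, x i • (Pi.single i (1 : ℝ) : Fin d → ℝ)) := by rw [← hx]
      _ ≤ ∑ i, nrm (x i • (Pi.single i (1 : ℝ) : Fin d → ℝ)) :=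
        Finset.le_sum_of_subadditive nrm (map_zero nrm).le (map_add_le_add nrm) _ _
      _ = _ := by simp [map_smul_eq_mul]
  refine Seminorm.continuous_of_continuousAt_zero ?_
  rw [ContinuousAt, map_zero]
  refine squeeze_zero (fun x => apply_nonneg nrm x) h ?_
  have : Continuous fun x : Fin d → ℝ => ∑ i, |x i| * nrm (Pi.single i 1) := by fun_prop
  simpa using this.tendsto 0

@[fun_prop]
lemma measurable_seminorm : Measurable nrm := (seminorm_continuous nrm).measurable

variable {nrm}

lemma transportCost_le {a b : Measure (Fin d → ℝ)} {ξ : Measure ((Fin d → ℝ) × (Fin d → ℝ))}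
    (h₁ : ξ.map Prod.fst = a) (h₂ : ξ.map Prod.snd = b) :
    transportCost nrm a b ≤ ∫⁻ z, ENNReal.ofReal (nrm (z.1 - z.2)) ∂ξ :=
  iInf₂_le _ ⟨h₁, h₂⟩

lemma measure_univ_of_mem_couplings {a b : Measure (Fin d → ℝ)}
    {ξ : Measure ((Fin d → ℝ) × (Fin d → ℝ))} (h : ξ ∈ couplings a b) :
    ξ Set.univ = a Set.univ ∧ ξ Set.univ = b Set.univ := by
  constructor
  · rw [← h.1, Measure.map_apply measurable_fst MeasurableSet.univ, Set.preimage_univ]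
  · rw [← h.2, Measure.map_apply measurable_snd MeasurableSet.univ, Set.preimage_univ]

lemma transportCost_map_map {X : Type*} [MeasurableSpace X] (a : Measure X)
    {g h : X → (Fin d → ℝ)} (hg : Measurable g) (hh : Measurable h) :
    transportCost nrm (a.map g) (a.map h) ≤ ∫⁻ x, ENNReal.ofReal (nrm (g x - h x)) ∂a := by
  refine (transportCost_le (ξ := a.map fun x => (g x, h x)) ?_ ?_).trans ?_
  · rw [Measure.map_map measurable_fst (hg.prodMk hh)]; rfl
  · rw [Measure.map_map measurable_snd (hg.prodMk hh)]; rfl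
  · rw [lintegral_map (by fun_prop) (hg.prodMk hh)]

lemma transportCost_self (a : Measure (Fin d → ℝ)) : transportCost nrm a a = 0 := by
  simpa using transportCost_map_map (nrm := nrm) a measurable_id measurable_id

lemma transportCost_comm (a b : Measure (Fin d → ℝ)) :
    transportCost nrm a b = transportCost nrm b a := by
  have key : ∀ a b : Measure (Fin d → ℝ), transportCost nrm a b ≤ transportCost nrm b a := by
    intro a b
    refine le_iInf₂ fun ξ hξ => ?_
    refine (transportCost_le (ξ := ξ.map Prod.swap) ?_ ?_).trans ?_
    · rw [Measure.map_map measurable_fst measurable_swap]; exact hξ.2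
    · rw [Measure.map_map measurable_snd measurable_swap]; exact hξ.1
    · rw [lintegral_map (by fun_prop) measurable_swap]
      simp [map_sub_rev nrm]
  exact le_antisymm (key a b) (key b a)

lemma transportCost_add_le (a b a' b' : Measure (Fin d → ℝ)) :
    transportCost nrm (a + a') (b + b') ≤ transportCost nrm a b + transportCost nrm a' b' := by
  conv_rhs => rw [transportCost, transportCost]
  simp only [ENNReal.iInf_add, ENNReal.add_iInf]
  refine le_iInf₂ fun ξ' hξ' => le_iInf₂ fun ξ hξ => ?_
  refine (transportCost_le (ξ := ξ + ξ') ?_ ?_).trans ?_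
  · rw [Measure.map_add _ _ measurable_fst, hξ.1, hξ'.1]
  · rw [Measure.map_add _ _ measurable_snd, hξ.2, hξ'.2]
  · rw [lintegral_add_measure]

lemma transportCost_add_right_le (a b c : Measure (Fin d → ℝ)) :
    transportCost nrm (a + c) (b + c) ≤ transportCost nrm a b := by
  simpa [transportCost_self] using transportCost_add_le (nrm := nrm) a b c c

lemma transportCost_smul_le (t : ℝ≥0∞) (a b : Measure (Fin d → ℝ)) (ht : t ≠ ∞ := by finiteness) :
    transportCost nrm (t • a) (t • b) ≤ t * transportCost nrm a b := by
  rcases eq_or_ne t 0 with rfl | h0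
  · simp [transportCost_self]
  conv_rhs => rw [transportCost]
  simp only [ENNReal.mul_iInf_of_ne h0 ht]
  refine le_iInf₂ fun ξ hξ => ?_
  refine (transportCost_le (ξ := t • ξ) ?_ ?_).trans ?_
  · rw [Measure.map_smul, hξ.1]
  · rw [Measure.map_smul, hξ.2]
  · rw [lintegral_smul_measure, smul_eq_mul]

/-- Gluing: both couplings are disintegrated over the middle marginal `b`, and the outer coordinates
are taken conditionally independent given the middle one. -/
lemma transportCost_triangle (a b c : Measure (Fin d → ℝ)) [IsFiniteMeasure b] :
    transportCost nrm a c ≤ transportCost nrm a b + transportCost nrm b c := by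
  conv_rhs => rw [transportCost, transportCost]
  simp only [ENNReal.iInf_add, ENNReal.add_iInf]
  refine le_iInf₂ fun ξ₂ h₂ => le_iInf₂ fun ξ₁ h₁ => ?_
  have f₁ : IsFiniteMeasure ξ₁ := ⟨by
    rw [(measure_univ_of_mem_couplings h₁).2]; exact measure_lt_top b _⟩
  have f₂ : IsFiniteMeasure ξ₂ := ⟨by
    rw [(measure_univ_of_mem_couplings h₂).1]; exact measure_lt_top b _⟩
  set k₁ := (ξ₁.map Prod.swap).condKernel
  set k₂ := ξ₂.condKernel
  have e₁ : b ⊗ₘ k₁ = ξ₁.map Prod.swap := by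
    have hb : b = (ξ₁.map Prod.swap).fst := by
      rw [Measure.fst, Measure.map_map measurable_fst measurable_swap]; exact h₁.2.symm
    conv_lhs => rw [hb]
    exact Measure.disintegrate _ _
  have e₂ : b ⊗ₘ k₂ = ξ₂ := by
    have hb : b = ξ₂.fst := h₂.1.symm
    conv_lhs => rw [hb]
    exact Measure.disintegrate _ _
  set η := b ⊗ₘ (k₁ ×ₖ k₂) with hη
  have m₁ : η.map (fun p => (p.2.1, p.1)) = ξ₁ := by
    have : η.map (Prod.map id Prod.fst) = b ⊗ₘ k₁ := by
      rw [hη, ← Measure.compProd_map measurable_fst, ← Kernel.fst_eq, Kernel.fst_prod]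
    rw [e₁] at this
    have h := congrArg (Measure.map Prod.swap) this
    rw [Measure.map_map measurable_swap (by fun_prop),
      Measure.map_map measurable_swap measurable_swap] at h
    simpa [Function.comp_def, Prod.map, Prod.swap] using h
  have m₂ : η.map (fun p => (p.1, p.2.2)) = ξ₂ := by
    have : η.map (Prod.map id Prod.snd) = b ⊗ₘ k₂ := by
      rw [hη, ← Measure.compProd_map measurable_snd, ← Kernel.snd_eq, Kernel.snd_prod]
    rw [e₂] at this
    exact this
  refine (transportCost_le (ξ := η.map fun p => p.2) ?_ ?_).trans ?_
  · rw [Measure.map_map measurable_fst measurable_snd, ← h₁.1, ← m₁,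
      Measure.map_map measurable_fst (by fun_prop)]
    rfl
  · rw [Measure.map_map measurable_snd measurable_snd, ← h₂.2, ← m₂,
      Measure.map_map measurable_snd (by fun_prop)]
    rfl
  · rw [lintegral_map (by fun_prop) measurable_snd, ← m₁, ← m₂,
      lintegral_map (by fun_prop) (by fun_prop), lintegral_map (by fun_prop) (by fun_prop),
      ← lintegral_add_left (by fun_prop)]
    refine lintegral_mono fun p => ?_
    rw [← ENNReal.ofReal_add (apply_nonneg _ _) (apply_nonneg _ _)]
    refine ENNReal.ofReal_le_ofReal ?_
    have := map_add_le_add nrm (p.2.1 - p.1) (p.1 - p.2.2)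
    simpa using this

/-- The copies of `a` are exchanged for copies of `b` one at a time; each exchange uses `c` together
with one copy and leaves the other copies in place. -/
lemma transportCost_nsmul_add_le (a b c : Measure (Fin d → ℝ)) [IsFiniteMeasure a]
    [IsFiniteMeasure b] [IsFiniteMeasure c] (n : ℕ) :
    transportCost nrm (n • a + c) (n • b + c) ≤ n * transportCost nrm (a + c) (b + c) := by
  induction n with
  | zero => simp [transportCost_self]
  | succ n ih =>
    have e₁ : (n + 1) • a + c = (a + c) + n • a := by rw [succ_nsmul]; abel
    have e₂ : (n + 1) • b + c = (n • b + c) + b := by rw [succ_nsmul]; abel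
    have e₃ : (b + c) + n • a = (n • a + c) + b := by abel
    calc transportCost nrm ((n + 1) • a + c) ((n + 1) • b + c)
        ≤ transportCost nrm ((n + 1) • a + c) ((b + c) + n • a) +
          transportCost nrm ((b + c) + n • a) ((n + 1) • b + c) := transportCost_triangle _ _ _
      _ ≤ transportCost nrm (a + c) (b + c) + transportCost nrm (n • a + c) (n • b + c) := by
          refine add_le_add ?_ ?_
          · rw [e₁]; exact transportCost_add_right_le _ _ _
          · rw [e₂, e₃]; exact transportCost_add_right_le _ _ _
      _ ≤ transportCost nrm (a + c) (b + c) + n * transportCost nrm (a + c) (b + c) := by gcongr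
      _ = _ := by push_cast; ring

/-- All mass is routed through the origin. -/
lemma transportCost_le_of_univ_eq {r s : Measure (Fin d → ℝ)} [IsFiniteMeasure r]
    (h : r Set.univ = s Set.univ) :
    transportCost nrm r s ≤
      ∫⁻ x, ENNReal.ofReal (nrm x) ∂r + ∫⁻ x, ENNReal.ofReal (nrm x) ∂s := by
  have h₁ : transportCost nrm r (r.map fun _ => 0) ≤ ∫⁻ x, ENNReal.ofReal (nrm x) ∂r := by
    simpa using transportCost_map_map (nrm := nrm) r measurable_id (measurable_const (a := 0))
  have h₂ : transportCost nrm (s.map fun _ => 0) s ≤ ∫⁻ x, ENNReal.ofReal (nrm x) ∂s := by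
    simpa using transportCost_map_map (nrm := nrm) s (measurable_const (a := 0)) measurable_id
  have e : (r.map fun _ => (0 : Fin d → ℝ)) = s.map fun _ => 0 := by
    rw [Measure.map_const, Measure.map_const, h]
  exact (transportCost_triangle _ (r.map fun _ => 0) _).trans (add_le_add h₁ (e ▸ h₂))

lemma lintegral_le_truncation {r a : Measure (Fin d → ℝ)} (h : r ≤ a) (R : ℝ≥0∞)
    (φ : (Fin d → ℝ) → ℝ≥0∞) :
    ∫⁻ x, φ x ∂r ≤ R * r Set.univ + ∫⁻ x, (φ x - R) ∂a := by
  calc ∫⁻ x, φ x ∂r ≤ ∫⁻ x, (R + (φ x - R)) ∂r := lintegral_mono fun x => le_add_tsub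
    _ = R * r Set.univ + ∫⁻ x, (φ x - R) ∂r := by
        rw [lintegral_add_left measurable_const, lintegral_const]
    _ ≤ _ := by gcongr

lemma exists_density_le_one {X : Type*} [MeasurableSpace X] {a ρ : Measure X} [IsFiniteMeasure ρ]
    (h : a ≤ ρ) : ∃ f : X → ℝ≥0∞, Measurable f ∧ (∀ x, f x ≤ 1) ∧ ρ.withDensity f = a := by
  have : IsFiniteMeasure a := isFiniteMeasure_of_le ρ h
  refine ⟨fun x => min (a.rnDeriv ρ x) 1, (Measure.measurable_rnDeriv a ρ).min measurable_const,
    fun x => min_le_right _ _, ?_⟩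
  rw [← Measure.withDensity_rnDeriv_eq a ρ (Measure.absolutelyContinuous_of_le h)]
  refine withDensity_congr_ae ?_
  rw [Measure.withDensity_rnDeriv_eq a ρ (Measure.absolutelyContinuous_of_le h)]
  filter_upwards [Measure.rnDeriv_le_one_of_le h] with x hx
  exact min_eq_left hx

/-- Weighting a coupling of `a + c` and `b + c` by the densities of `a` and `b` keeps the mass that
starts in `a` and ends in `b`. What is left of `a` and `b` has mass at most that of `c` and goes
through the origin; below radius `R` this costs at most `R` per unit of mass, and the excess is the
tail integral. This is useful when `c` is small. -/
lemma transportCost_le_add_tail (a b c : Measure (Fin d → ℝ)) [IsFiniteMeasure a]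
    [IsFiniteMeasure b] [IsFiniteMeasure c] (hab : a Set.univ = b Set.univ) (R : ℝ≥0∞) :
    transportCost nrm a b ≤ transportCost nrm (a + c) (b + c) + 2 * (R * c Set.univ) +
      (∫⁻ x, (ENNReal.ofReal (nrm x) - R) ∂a + ∫⁻ x, (ENNReal.ofReal (nrm x) - R) ∂b) := by
  rw [add_assoc]
  conv_rhs => rw [transportCost]
  simp only [ENNReal.iInf_add]
  refine le_iInf₂ fun ξ hξ => ?_
  have fξ : IsFiniteMeasure ξ := ⟨by
    rw [(measure_univ_of_mem_couplings hξ).2]; exact measure_lt_top (b + c) _⟩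
  obtain ⟨f, hf, hf1, hfa⟩ := exists_density_le_one (Measure.le_add_right le_rfl : a ≤ a + c)
  obtain ⟨g, hg, hg1, hgb⟩ := exists_density_le_one (Measure.le_add_right le_rfl : b ≤ b + c)
  have ef : ∀ s, MeasurableSet s → ∫⁻ z in Prod.fst ⁻¹' s, f z.1 ∂ξ = a s := by
    intro s hs
    rw [← hfa, withDensity_apply _ hs, ← hξ.1, setLIntegral_map hs hf measurable_fst]
  have eg : ∀ s, MeasurableSet s → ∫⁻ z in Prod.snd ⁻¹' s, g z.2 ∂ξ = b s := by
    intro s hs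
    rw [← hgb, withDensity_apply _ hs, ← hξ.2, setLIntegral_map hs hg measurable_snd]
  set ζ := ξ.withDensity fun z => f z.1 * g z.2 with hζ
  have hle : ∀ z : (Fin d → ℝ) × (Fin d → ℝ), f z.1 * g z.2 ≤ 1 := fun z =>
    mul_le_one' (hf1 _) (hg1 _)
  have ζle : ζ ≤ ξ := by
    refine Measure.le_iff.2 fun s hs => ?_
    rw [hζ, withDensity_apply _ hs]
    calc _ ≤ ∫⁻ z in s, 1 ∂ξ := lintegral_mono hle
      _ = ξ s := by simp
  have fζ : IsFiniteMeasure ζ := isFiniteMeasure_of_le ξ ζle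
  have ha : ζ.map Prod.fst ≤ a := by
    refine Measure.le_iff.2 fun s hs => ?_
    rw [Measure.map_apply measurable_fst hs, hζ, withDensity_apply _ (measurable_fst hs), ← ef s hs]
    exact lintegral_mono fun z => mul_le_of_le_one_right' (hg1 _)
  have hb : ζ.map Prod.snd ≤ b := by
    refine Measure.le_iff.2 fun s hs => ?_
    rw [Measure.map_apply measurable_snd hs, hζ, withDensity_apply _ (measurable_snd hs), ← eg s hs]
    exact lintegral_mono fun z => mul_le_of_le_one_left' (hf1 _)
  have ua : (ζ.map Prod.fst) Set.univ = ζ Set.univ := by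
    rw [Measure.map_apply measurable_fst .univ, Set.preimage_univ]
  have ub : (ζ.map Prod.snd) Set.univ = ζ Set.univ := by
    rw [Measure.map_apply measurable_snd .univ, Set.preimage_univ]
  set r := a - ζ.map Prod.fst with hr
  set s := b - ζ.map Prod.snd with hs
  have hra : r + ζ.map Prod.fst = a := Measure.sub_add_cancel_of_le ha
  have hsb : s + ζ.map Prod.snd = b := Measure.sub_add_cancel_of_le hb
  have ru : r Set.univ = a Set.univ - ζ Set.univ := by
    rw [hr, Measure.sub_apply .univ ha, ua]
  have su : s Set.univ = b Set.univ - ζ Set.univ := by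
    rw [hs, Measure.sub_apply .univ hb, ub]
  have hrs : r Set.univ = s Set.univ := by rw [ru, su, hab]
  have hmass : r Set.univ ≤ c Set.univ := by
    rw [ru, tsub_le_iff_left]
    -- This is `(1 - f) * (1 - g) ≥ 0`, integrated over `ξ`.
    have h1 : a Set.univ + b Set.univ ≤ ζ Set.univ + ξ Set.univ := by
      rw [hζ, withDensity_apply _ .univ, ← ef _ .univ, ← eg _ .univ, Set.preimage_univ,
        Set.preimage_univ, Measure.restrict_univ, ← lintegral_add_left (by fun_prop),
        ← lintegral_one (μ := ξ), ← lintegral_add_right _ measurable_const]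
      refine lintegral_mono fun z => ?_
      have h1 := hf1 z.1
      have h2 := hg1 z.2
      show f z.1 + g z.2 ≤ f z.1 * g z.2 + 1
      lift f z.1 to NNReal using ne_top_of_le_ne_top ENNReal.one_ne_top h1 with u
      lift g z.2 to NNReal using ne_top_of_le_ne_top ENNReal.one_ne_top h2 with v
      norm_cast at h1 h2 ⊢
      have h1' : (u : ℝ) ≤ 1 := h1
      have h2' : (v : ℝ) ≤ 1 := h2
      have : (u : ℝ) + v ≤ u * v + 1 := by nlinarith
      exact_mod_cast this
    have h2 : ξ Set.univ = b Set.univ + c Set.univ := (measure_univ_of_mem_couplings hξ).2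
    rw [h2] at h1
    have h3 : a Set.univ + b Set.univ ≤ (ζ Set.univ + c Set.univ) + b Set.univ := by
      refine h1.trans (le_of_eq (by ring))
    exact (ENNReal.add_le_add_iff_right (measure_ne_top b _)).1 h3
  have hr' : IsFiniteMeasure r := isFiniteMeasure_of_le a Measure.sub_le
  calc transportCost nrm a b
      = transportCost nrm (r + ζ.map Prod.fst) (s + ζ.map Prod.snd) := by rw [hra, hsb]
    _ ≤ transportCost nrm r s + transportCost nrm (ζ.map Prod.fst) (ζ.map Prod.snd) :=
        transportCost_add_le _ _ _ _
    _ ≤ ((R * c Set.univ + ∫⁻ x, (ENNReal.ofReal (nrm x) - R) ∂a) +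
          (R * c Set.univ + ∫⁻ x, (ENNReal.ofReal (nrm x) - R) ∂b)) +
        ∫⁻ z, ENNReal.ofReal (nrm (z.1 - z.2)) ∂ξ := by
        refine add_le_add ((transportCost_le_of_univ_eq hrs).trans (add_le_add ?_ ?_))
          ((transportCost_le rfl rfl).trans (lintegral_mono' ζle le_rfl))
        · refine (lintegral_le_truncation Measure.sub_le R _).trans ?_
          gcongr
        · refine (lintegral_le_truncation Measure.sub_le R _).trans ?_
          rw [hrs] at hmass
          gcongr
    _ = _ := by ring

lemma tendsto_lintegral_tsub (a : Measure (Fin d → ℝ)) {φ : (Fin d → ℝ) → ℝ≥0∞}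
    (hφ : Measurable φ) (h : ∫⁻ x, φ x ∂a ≠ ∞) :
    Tendsto (fun n : ℕ => ∫⁻ x, (φ x - n) ∂a) atTop (𝓝 0) := by
  have key := tendsto_lintegral_of_dominated_convergence (μ := a) (F := fun (n : ℕ) x => φ x - n)
    (f := fun _ => 0) φ (fun n => by fun_prop) (fun n => ae_of_all _ fun x => tsub_le_self) h ?_
  · simpa using key
  · filter_upwards [ae_lt_top hφ h] with x hx
    refine tendsto_const_nhds.congr' ?_
    obtain ⟨n, hn⟩ := ENNReal.exists_nat_gt hx.ne
    filter_upwards [eventually_ge_atTop n] with m hm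
    exact (tsub_eq_zero_of_le (hn.le.trans (by exact_mod_cast hm))).symm

/-- Cancellation: a common part of two measures does not help to transport one to the other. -/
lemma transportCost_le_transportCost_add (a b c : Measure (Fin d → ℝ)) [IsFiniteMeasure a]
    [IsFiniteMeasure b] [IsFiniteMeasure c] (hab : a Set.univ = b Set.univ)
    (ha : ∫⁻ x, ENNReal.ofReal (nrm x) ∂a ≠ ∞) (hb : ∫⁻ x, ENNReal.ofReal (nrm x) ∂b ≠ ∞) :
    transportCost nrm a b ≤ transportCost nrm (a + c) (b + c) := by
  have key : ∀ n R : ℕ, transportCost nrm a b ≤ transportCost nrm (a + c) (b + c) +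
      2 * (R * ((n + 1 : ℕ) : ℝ≥0∞)⁻¹ * c Set.univ) +
      (∫⁻ x, (ENNReal.ofReal (nrm x) - R) ∂a + ∫⁻ x, (ENNReal.ofReal (nrm x) - R) ∂b) := by
    intro n R
    -- Adding only the fraction `t⁻¹` of `c` amounts to `t` copies of `a` plus one `c`, rescaled, so
    -- the exchange argument bounds its cost by that of `a + c` and `b + c`.
    set t : ℝ≥0∞ := ((n + 1 : ℕ) : ℝ≥0∞) with ht
    have ht0 : t ≠ 0 := by rw [ht]; exact_mod_cast n.succ_ne_zero
    have htt : t ≠ ∞ := ENNReal.natCast_ne_top _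
    have hti : t⁻¹ ≠ ∞ := ENNReal.inv_ne_top.2 ht0
    have fc : IsFiniteMeasure (t⁻¹ • c) := ⟨by
      rw [Measure.smul_apply, smul_eq_mul]
      exact ENNReal.mul_lt_top hti.lt_top (measure_lt_top c _)⟩
    have h1 := transportCost_le_add_tail (nrm := nrm) a b (t⁻¹ • c) hab R
    have e : ∀ a : Measure (Fin d → ℝ), a + t⁻¹ • c = t⁻¹ • ((n + 1) • a + c) := by
      intro a
      rw [smul_add, ← Nat.cast_smul_eq_nsmul ℝ≥0∞, smul_smul, ← ht, ENNReal.inv_mul_cancel ht0 htt,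
        one_smul]
    have h2 : transportCost nrm (a + t⁻¹ • c) (b + t⁻¹ • c) ≤ transportCost nrm (a + c) (b + c) := by
      rw [e a, e b]
      refine (transportCost_smul_le _ _ _ hti).trans ?_
      refine (mul_le_mul_right (transportCost_nsmul_add_le a b c (n + 1)) _).trans ?_
      rw [← mul_assoc, ← ht, ENNReal.inv_mul_cancel ht0 htt, one_mul]
    refine h1.trans ?_
    rw [Measure.smul_apply, smul_eq_mul, ← mul_assoc (R : ℝ≥0∞)]
    gcongr
  -- The fraction of `c` must vanish while `R` is still fixed; only afterwards may `R` tend to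
  -- infinity to remove the tails.
  have key2 : ∀ R : ℕ, transportCost nrm a b ≤ transportCost nrm (a + c) (b + c) +
      (∫⁻ x, (ENNReal.ofReal (nrm x) - R) ∂a + ∫⁻ x, (ENNReal.ofReal (nrm x) - R) ∂b) := by
    intro R
    refine ge_of_tendsto' (f := fun n : ℕ => transportCost nrm (a + c) (b + c) +
      2 * (R * ((n + 1 : ℕ) : ℝ≥0∞)⁻¹ * c Set.univ) +
      (∫⁻ x, (ENNReal.ofReal (nrm x) - R) ∂a + ∫⁻ x, (ENNReal.ofReal (nrm x) - R) ∂b))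
      (x := atTop) ?_ (fun n => key n R)
    have h0 : Tendsto (fun n : ℕ => ((n + 1 : ℕ) : ℝ≥0∞)⁻¹) atTop (𝓝 0) :=
      ENNReal.tendsto_inv_nat_nhds_zero.comp (tendsto_add_atTop_nat 1)
    have h1 : Tendsto (fun n : ℕ => 2 * (R * ((n + 1 : ℕ) : ℝ≥0∞)⁻¹ * c Set.univ)) atTop
        (𝓝 (2 * (R * 0 * c Set.univ))) := by
      refine ENNReal.Tendsto.const_mul (ENNReal.Tendsto.mul_const
        (ENNReal.Tendsto.const_mul h0 (Or.inr (by finiteness))) (Or.inr (by finiteness)))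
        (Or.inr (by finiteness))
    simpa using (tendsto_const_nhds.add h1).add tendsto_const_nhds
  refine ge_of_tendsto' (f := fun R : ℕ => transportCost nrm (a + c) (b + c) +
      (∫⁻ x, (ENNReal.ofReal (nrm x) - R) ∂a + ∫⁻ x, (ENNReal.ofReal (nrm x) - R) ∂b))
      (x := atTop) ?_ key2
  simpa using tendsto_const_nhds.add ((tendsto_lintegral_tsub a (by fun_prop) ha).add
    (tendsto_lintegral_tsub b (by fun_prop) hb))

end TransportCost

/-! ### The common part of two finite measures. -/

section MeasureSub

variable {X : Type*} [MeasurableSpace X]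

/-- The witness is the minimum of the two measures, `a - (a - b)`. The second identity follows from
comparing `a - b` and `b - a` as signed measures. -/
lemma exists_common_part (a b : Measure X) [IsFiniteMeasure a] [IsFiniteMeasure b] :
    ∃ m : Measure X, IsFiniteMeasure m ∧ a = m + (a - b) ∧ b = m + (b - a) := by
  have hle : a - b ≤ a := Measure.sub_le
  have hm : a - (a - b) + (a - b) = a := Measure.sub_add_cancel_of_le hle
  refine ⟨a - (a - b), inferInstance, hm.symm, ?_⟩
  have h : a + (b - a) = b + (a - b) := by
    have h1 := Measure.sub_toSignedMeasure_eq_toSignedMeasure_sub (μ := a) (ν := b)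
    rw [sub_eq_sub_iff_add_eq_add, ← Measure.toSignedMeasure_add,
      ← Measure.toSignedMeasure_add] at h1
    rw [add_comm b]
    exact (Measure.toSignedMeasure_eq_toSignedMeasure_iff).1 h1
  ext s hs
  have h2 := congrArg (fun μ : Measure X => μ s) h
  have h3 := congrArg (fun μ : Measure X => μ s) hm
  simp only [Measure.add_apply] at h2 h3 ⊢
  rw [← h3, add_right_comm] at h2
  exact ((ENNReal.add_left_inj (measure_ne_top (a - b) s)).1 h2).symm

/-- By mutual singularity one of the two truncated differences vanishes at the point. -/
lemma sub_apply_add_sub_apply_singleton [MeasurableSingletonClass X] (a b : Measure X)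
    [IsFiniteMeasure a] [IsFiniteMeasure b] (x : X) :
    (a - b) {x} + (b - a) {x} = ENNReal.ofReal |a.real {x} - b.real {x}| := by
  obtain ⟨m, hm, h₁, h₂⟩ := exists_common_part a b
  obtain ⟨s, hs, hs1, hs2⟩ := Measure.mutually_singular_measure_sub (μ := a) (ν := b)
  have e₁ : a.real {x} = m.real {x} + (a - b).real {x} := by
    rw [← measureReal_add_apply, ← h₁]
  have e₂ : b.real {x} = m.real {x} + (b - a).real {x} := by
    rw [← measureReal_add_apply, ← h₂]
  have e₃ : a.real {x} - b.real {x} = (a - b).real {x} - (b - a).real {x} := by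
    rw [e₁, e₂]; ring
  rw [e₃]
  by_cases hx : x ∈ s
  · have h0 : (a - b) {x} = 0 := measure_mono_null (Set.singleton_subset_iff.2 hx) hs1
    simp [measureReal_def, h0]
  · have h0 : (b - a) {x} = 0 :=
      measure_mono_null (Set.singleton_subset_iff.2 (Set.mem_compl hx)) hs2
    simp [measureReal_def, h0]

lemma absSub_eq {d : ℕ} (μ ν : Measure (Fin d → ℝ)) [IsFiniteMeasure μ] [IsFiniteMeasure ν] :
    absSub μ ν = (μ - ν) + (ν - μ) := by
  rw [absSub, SignedMeasure.totalVariation, Measure.toJordanDecomposition_toSignedMeasure_sub]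
  rfl

lemma sub_univ_eq_sub_univ (a b : Measure X) [IsProbabilityMeasure a] [IsProbabilityMeasure b] :
    (a - b) Set.univ = (b - a) Set.univ := by
  obtain ⟨m, hm, h₁, h₂⟩ := exists_common_part a b
  have e₁ := congrArg (fun μ : Measure X => μ Set.univ) h₁
  have e₂ := congrArg (fun μ : Measure X => μ Set.univ) h₂
  simp only [Measure.add_apply, measure_univ] at e₁ e₂
  exact (ENNReal.add_right_inj (measure_ne_top m _)).1 (e₁.symm.trans e₂)

end MeasureSub

/-! ### Moments of empirical frequencies. -/

section Sampling

variable {X : Type*} [MeasurableSpace X]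

/-- The mean absolute deviation of the frequency of an event is at most the standard deviation. -/
lemma lintegral_abs_frequency_sub_le (μ : Measure X) [IsProbabilityMeasure μ] {N : ℕ} (hN : 1 ≤ N)
    {C : Set X} (hC : MeasurableSet C) :
    ∫⁻ x, ENNReal.ofReal |(N : ℝ)⁻¹ * ∑ i, C.indicator (fun _ => (1 : ℝ)) (x i) - μ.real C|
      ∂(Measure.pi fun _ : Fin N => μ) ≤ (μ C / N) ^ (1 / 2 : ℝ) := by
  set P := Measure.pi fun _ : Fin N => μ with hP
  set f : X → ℝ := C.indicator fun _ => 1 with hf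
  have mf : Measurable f := measurable_const.indicator hC
  have f01 : ∀ x, f x ∈ Set.Icc (0 : ℝ) 1 := by
    intro x; by_cases h : x ∈ C <;> simp [hf, h]
  have hN0 : (N : ℝ) ≠ 0 := by exact_mod_cast (by omega : N ≠ 0)
  have Lf : MemLp f 2 μ := MemLp.of_bound mf.aestronglyMeasurable 1
    (ae_of_all _ fun x => by
      rw [Real.norm_eq_abs, abs_le]; exact ⟨by linarith [(f01 x).1], (f01 x).2⟩)
  have Ef : ∫ x, f x ∂μ = μ.real C := by
    rw [hf, integral_indicator_const _ hC]; simp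
  have mp : ∀ i : Fin N, MeasurePreserving (fun x : Fin N → X => x i) P μ := fun i =>
    measurePreserving_eval (fun _ : Fin N => μ) i
  have Lfi : ∀ i : Fin N, MemLp (fun x : Fin N → X => f (x i)) 2 P := fun i =>
    Lf.comp_measurePreserving (mp i)
  have Efi : ∀ i : Fin N, ∫ x, f (x i) ∂P = μ.real C := by
    intro i
    rw [← Ef, ← (mp i).map_eq, integral_map (mp i).measurable.aemeasurable]
    rw [(mp i).map_eq]; exact mf.aestronglyMeasurable
  have Vf : Var[f; μ] ≤ μ.real C := by
    have h1 := variance_le_expectation_sq (X := f) (μ := μ) mf.aestronglyMeasurable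
    refine h1.trans (le_of_eq ?_)
    rw [← Ef]
    refine integral_congr_ae (ae_of_all _ fun x => ?_)
    by_cases h : x ∈ C <;> simp [hf, h]
  have Vfi : ∀ i : Fin N, Var[fun x : Fin N → X => f (x i); P] = Var[f; μ] := by
    intro i
    have := variance_map (μ := P) (X := f) (Y := fun x : Fin N → X => x i)
      (by rw [(mp i).map_eq]; exact mf.aemeasurable) (mp i).measurable.aemeasurable
    rw [(mp i).map_eq] at this
    exact this.symm
  set S : (Fin N → X) → ℝ := fun x => (N : ℝ)⁻¹ * ∑ i, f (x i) with hS
  have mS : Measurable S := by fun_prop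
  have LS : MemLp S 2 P := (memLp_finsetSum _ fun i _ => Lfi i).const_mul _
  have ES : ∫ x, S x ∂P = μ.real C := by
    rw [hS, integral_const_mul, integral_finsetSum _ fun i _ => (Lfi i).integrable one_le_two]
    simp [Efi, hN0]
  have VS : Var[S; P] ≤ μ.real C / N := by
    have ind : iIndepFun (fun (i : Fin N) (x : Fin N → X) => f (x i)) P :=
      iIndepFun_pi (μ := fun _ : Fin N => μ) (X := fun _ => f) fun _ => mf.aemeasurable
    have h1 : Var[fun x => ∑ i, f (x i); P] = N * Var[f; μ] := by
      have := IndepFun.variance_sum (s := Finset.univ) (μ := P)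
        (X := fun (i : Fin N) (x : Fin N → X) => f (x i)) (fun i _ => Lfi i)
        (fun i _ j _ hij => ind.indepFun hij)
      have e : (∑ i, fun x : Fin N → X => f (x i)) = fun x => ∑ i, f (x i) := by
        ext x; simp
      rw [e] at this
      rw [this]; simp [Vfi]
    rw [hS, variance_const_mul, h1]
    have : ((N : ℝ)⁻¹) ^ 2 * (N * Var[f; μ]) = Var[f; μ] / N := by field_simp
    rw [this]
    gcongr
  have hev : ∫⁻ x, ‖S x - μ.real C‖ₑ ^ 2 ∂P ≤ μ C / N := by
    have h1 : eVar[S; P] = ENNReal.ofReal Var[S; P] := (LS.ofReal_variance_eq).symm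
    rw [evariance, ES] at h1
    rw [h1]
    refine (ENNReal.ofReal_le_ofReal VS).trans (le_of_eq ?_)
    rw [ENNReal.ofReal_div_of_pos (by positivity), measureReal_def,
      ENNReal.ofReal_toReal (measure_ne_top _ _), ENNReal.ofReal_natCast]
  have h2 := eLpNorm_le_eLpNorm_of_exponent_le (μ := P) (p := 1) (q := 2)
    (f := fun x => S x - μ.real C) one_le_two (mS.sub_const _).aestronglyMeasurable
  rw [eLpNorm_one_eq_lintegral_enorm, eLpNorm_eq_lintegral_rpow_enorm_toReal (by simp) (by simp)]
    at h2
  simp only [ENNReal.toReal_ofNat, ENNReal.rpow_ofNat] at h2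
  calc ∫⁻ x, ENNReal.ofReal |S x - μ.real C| ∂P = ∫⁻ x, ‖S x - μ.real C‖ₑ ∂P := by
        simp only [Real.enorm_eq_ofReal_abs]
    _ ≤ _ := h2
    _ ≤ _ := ENNReal.rpow_le_rpow hev (by norm_num)

lemma lintegral_pi_average (μ : Measure X) [IsProbabilityMeasure μ] {N : ℕ} (hN : 1 ≤ N)
    {φ : X → ℝ≥0∞} (hφ : Measurable φ) :
    ∫⁻ x, (N : ℝ≥0∞)⁻¹ * ∑ i, φ (x i) ∂(Measure.pi fun _ : Fin N => μ) = ∫⁻ y, φ y ∂μ := by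
  have hN0 : (N : ℝ≥0∞) ≠ 0 := by exact_mod_cast (by omega : N ≠ 0)
  rw [lintegral_const_mul _ (by fun_prop), lintegral_finsetSum _ fun i _ => by fun_prop]
  have : ∀ i : Fin N, ∫⁻ x : Fin N → X, φ (x i) ∂(Measure.pi fun _ => μ) = ∫⁻ y, φ y ∂μ :=
    fun i => (measurePreserving_eval (fun _ : Fin N => μ) i).lintegral_comp hφ
  simp only [this, Finset.sum_const, Finset.card_univ, Fintype.card_fin, nsmul_eq_mul]
  rw [← mul_assoc, ENNReal.inv_mul_cancel hN0 (ENNReal.natCast_ne_top N), one_mul]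

end Sampling

/-! ### Empirical measures and measurability of their transport cost. -/

section Empirical

variable {d N : ℕ} {nrm : Seminorm ℝ (Fin d → ℝ)}

lemma lintegral_empirical (x : Fin N → (Fin d → ℝ)) (φ : (Fin d → ℝ) → ℝ≥0∞) :
    ∫⁻ y, φ y ∂(empirical x) = (N : ℝ≥0∞)⁻¹ * ∑ i, φ (x i) := by
  simp [empirical, lintegral_finsetSum_measure]

lemma isProbabilityMeasure_empirical (hN : 1 ≤ N) (x : Fin N → (Fin d → ℝ)) :
    IsProbabilityMeasure (empirical x) := by
  have hN0 : (N : ℝ≥0∞) ≠ 0 := by exact_mod_cast (by omega : N ≠ 0)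
  constructor
  simp [empirical, ENNReal.inv_mul_cancel hN0]

lemma empirical_real_apply (x : Fin N → (Fin d → ℝ)) {C : Set (Fin d → ℝ)}
    (hC : MeasurableSet C) :
    (empirical x).real C = (N : ℝ)⁻¹ * ∑ i, C.indicator (fun _ => (1 : ℝ)) (x i) := by
  rw [measureReal_def, empirical]
  simp only [Measure.smul_apply, Measure.coe_finsetSum, Finset.sum_apply, smul_eq_mul,
    Measure.dirac_apply' _ hC]
  rw [ENNReal.toReal_mul, ENNReal.toReal_inv, ENNReal.toReal_natCast, ENNReal.toReal_sum]
  · congr 1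
    refine Finset.sum_congr rfl fun i _ => ?_
    by_cases h : x i ∈ C <;> simp [h]
  · intro i _
    by_cases h : x i ∈ C <;> simp [h]

lemma transportCost_empirical_le (x y : Fin N → (Fin d → ℝ)) :
    transportCost nrm (empirical x) (empirical y) ≤
      (N : ℝ≥0∞)⁻¹ * ∑ i, ENNReal.ofReal (nrm (x i - y i)) := by
  have e : ∀ x : Fin N → (Fin d → ℝ),
      empirical x = ((N : ℝ≥0∞)⁻¹ • ∑ i, Measure.dirac i : Measure (Fin N)).map x := by
    intro x
    ext s hs
    rw [Measure.map_apply (measurable_from_top) hs]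
    simp [empirical, Measure.dirac_apply' _ hs, Set.indicator]
    rfl
  rw [e x, e y]
  refine (transportCost_map_map _ measurable_from_top measurable_from_top).trans ?_
  rw [lintegral_smul_measure, lintegral_finsetSum_measure]
  simp

/-- An infimum over couplings is not obviously measurable. By the triangle inequality, moving the
sample points slightly lowers the cost by at most their mean displacement, which gives lower
semicontinuity, also where the cost is infinite. -/
lemma measurable_transportCost_empirical (hN : 1 ≤ N) (μ : Measure (Fin d → ℝ)) :
    Measurable fun x : Fin N → (Fin d → ℝ) => transportCost nrm μ (empirical x) := by
  refine LowerSemicontinuous.measurable fun x₀ y hy => ?_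
  set ω : (Fin N → (Fin d → ℝ)) → ℝ≥0∞ := fun x =>
    (N : ℝ≥0∞)⁻¹ * ∑ i, ENNReal.ofReal (nrm (x i - x₀ i)) with hω
  have hN0 : (N : ℝ≥0∞) ≠ 0 := by exact_mod_cast (by omega : N ≠ 0)
  have cω : Continuous ω := by
    have := seminorm_continuous nrm
    refine (ENNReal.continuous_const_mul (ENNReal.inv_ne_top.2 hN0)).comp
      (continuous_finsetSum _ fun i _ => ENNReal.continuous_ofReal.comp (this.comp (by fun_prop)))
  have h0 : Tendsto ω (𝓝 x₀) (𝓝 0) := by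
    simpa [hω] using cω.tendsto x₀
  have h1 : Tendsto (fun x => transportCost nrm μ (empirical x₀) - ω x) (𝓝 x₀)
      (𝓝 (transportCost nrm μ (empirical x₀))) := by
    simpa using ENNReal.Tendsto.sub (tendsto_const_nhds (x := transportCost nrm μ (empirical x₀)))
      h0 (Or.inr ENNReal.zero_ne_top)
  filter_upwards [h1.eventually (lt_mem_nhds hy)] with x hx
  refine hx.trans_le (tsub_le_iff_right.2 ?_)
  have := isProbabilityMeasure_empirical hN x
  exact (transportCost_triangle μ (empirical x) (empirical x₀)).trans
    (by gcongr; exact transportCost_empirical_le _ _)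

end Empirical

/-! ### Comparison of the norm with the maximum norm. -/

section CubeDiam

variable {d : ℕ} (nrm : Seminorm ℝ (Fin d → ℝ))

lemma bddAbove_cubeDiam : BddAbove {r | ∃ x y : Fin d → ℝ, (∀ i, x i ∈ Set.Ico (0 : ℝ) 1) ∧
    (∀ i, y i ∈ Set.Ico (0 : ℝ) 1) ∧ r = nrm (x - y)} := by
  obtain ⟨C, hC⟩ := (isCompact_closedBall (0 : Fin d → ℝ) 1).bddAbove_image
    (seminorm_continuous nrm).continuousOn
  refine ⟨C, ?_⟩
  rintro r ⟨x, y, hx, hy, rfl⟩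
  refine hC ⟨x - y, ?_, rfl⟩
  rw [mem_closedBall_zero_iff, pi_norm_le_iff_of_nonneg zero_le_one]
  intro i
  rw [Pi.sub_apply, Real.norm_eq_abs, abs_le]
  constructor <;> linarith [(hx i).1, (hx i).2, (hy i).1, (hy i).2]

lemma cubeDiam_nonneg : 0 ≤ cubeDiam nrm :=
  Real.sSup_nonneg (by rintro r ⟨x, y, -, -, rfl⟩; exact apply_nonneg _ _)

/-- A vector of maximum norm below 1 is the difference of its positive and negative parts, both of
which lie in the half-open cube. -/
lemma seminorm_le_cubeDiam {v : Fin d → ℝ} (hv : ‖v‖ < 1) : nrm v ≤ cubeDiam nrm := by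
  refine le_csSup (bddAbove_cubeDiam nrm) ⟨fun i => max (v i) 0, fun i => max (-v i) 0, ?_, ?_, ?_⟩
  · intro i
    have := (norm_le_pi_norm v i).trans_lt hv
    rw [Real.norm_eq_abs, abs_lt] at this
    exact ⟨le_max_right _ _, max_lt this.2 zero_lt_one⟩
  · intro i
    have := (norm_le_pi_norm v i).trans_lt hv
    rw [Real.norm_eq_abs, abs_lt] at this
    exact ⟨le_max_right _ _, max_lt (by linarith) zero_lt_one⟩
  · congr 1
    ext i
    simp only [Pi.sub_apply]
    rcases le_total (v i) 0 with h | h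
    · rw [max_eq_right h, max_eq_left (by linarith)]; ring
    · rw [max_eq_left h, max_eq_right (by linarith)]; ring

/-- Rescaling uses `‖v‖ + ε`, because the previous bound needs a strict inequality and `v` may be
zero. -/
lemma seminorm_le_cubeDiam_mul (v : Fin d → ℝ) : nrm v ≤ cubeDiam nrm * ‖v‖ := by
  have key : ∀ ε > 0, nrm v ≤ cubeDiam nrm * (‖v‖ + ε) := by
    intro ε hε
    have hpos : 0 < ‖v‖ + ε := by positivity
    have h := seminorm_le_cubeDiam nrm (v := (‖v‖ + ε)⁻¹ • v) (by
      rw [norm_smul, norm_inv, Real.norm_of_nonneg hpos.le, inv_mul_lt_iff₀ hpos]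
      linarith)
    rw [map_smul_eq_mul, norm_inv, Real.norm_of_nonneg hpos.le, inv_mul_le_iff₀ hpos] at h
    linarith
  have h1 : Tendsto (fun ε : ℝ => cubeDiam nrm * (‖v‖ + ε)) (𝓝[>] 0)
      (𝓝 (cubeDiam nrm * (‖v‖ + 0))) := by
    refine Tendsto.mono_left ?_ nhdsWithin_le_nhds
    exact (by fun_prop : Continuous fun ε : ℝ => cubeDiam nrm * (‖v‖ + ε)).tendsto 0
  rw [add_zero] at h1
  exact ge_of_tendsto h1 (eventually_mem_nhdsWithin.mono fun ε hε => key ε hε)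

end CubeDiam

/-! ### Dyadic shells, cubes, and chaining over generations. -/

section Refinement

variable {d : ℕ} {nrm : Seminorm ℝ (Fin d → ℝ)}

/-- Comparison of the transport costs of two pairs of images of the same two measures. -/
lemma transportCost_map_le_add {X : Type*} [MeasurableSpace X] (a b : Measure X)
    [IsProbabilityMeasure a] [IsProbabilityMeasure b] {g h : X → (Fin d → ℝ)} (hg : Measurable g)
    (hh : Measurable h) (ha : ∫⁻ x, ENNReal.ofReal (nrm (h x)) ∂a ≠ ∞)
    (hb : ∫⁻ x, ENNReal.ofReal (nrm (h x)) ∂b ≠ ∞) :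
    transportCost nrm (a.map g) (b.map g) ≤ transportCost nrm (a.map h) (b.map h) +
      ∫⁻ x, ENNReal.ofReal (nrm (g x - h x)) ∂((a - b) + (b - a)) := by
  obtain ⟨m, hm, h₁, h₂⟩ := exists_common_part a b
  have hu := sub_univ_eq_sub_univ a b
  set p := a - b
  set n := b - a
  have hp : p ≤ a := Measure.sub_le
  have hn : n ≤ b := Measure.sub_le
  have fp : IsFiniteMeasure p := isFiniteMeasure_of_le a hp
  have fn : IsFiniteMeasure n := isFiniteMeasure_of_le b hn
  rw [lintegral_add_measure]
  calc transportCost nrm (a.map g) (b.map g)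
      = transportCost nrm (p.map g + m.map g) (n.map g + m.map g) := by
        rw [← Measure.map_add _ _ hg, ← Measure.map_add _ _ hg, add_comm p, add_comm n, ← h₁, ← h₂]
    _ ≤ transportCost nrm (p.map g) (n.map g) := transportCost_add_right_le _ _ _
    _ ≤ transportCost nrm (p.map g) (p.map h) + (transportCost nrm (p.map h) (n.map h) +
          transportCost nrm (n.map h) (n.map g)) :=
        (transportCost_triangle _ (p.map h) _).trans
          (by gcongr; exact transportCost_triangle _ (n.map h) _)
    _ ≤ ∫⁻ x, ENNReal.ofReal (nrm (g x - h x)) ∂p +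
          (transportCost nrm (a.map h) (b.map h) +
            ∫⁻ x, ENNReal.ofReal (nrm (g x - h x)) ∂n) := by
        refine add_le_add (transportCost_map_map _ hg hh) (add_le_add ?_ ?_)
        -- Here cancellation is indispensable: the coarse cost of the differences is bounded by that
        -- of the full measures.
        · conv_rhs => rw [h₁, h₂, add_comm m, add_comm m, Measure.map_add _ _ hh,
            Measure.map_add _ _ hh]
          refine transportCost_le_transportCost_add _ _ _ ?_ ?_ ?_
          · rw [Measure.map_apply hh .univ, Measure.map_apply hh .univ]; exact hu
          · rw [lintegral_map (by fun_prop) hh]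
            exact ne_top_of_le_ne_top ha (lintegral_mono' hp le_rfl)
          · rw [lintegral_map (by fun_prop) hh]
            exact ne_top_of_le_ne_top hb (lintegral_mono' hn le_rfl)
        · rw [transportCost_comm]
          exact transportCost_map_map _ hg hh
    _ = _ := by ring

/-- The index of the dyadic shell around the origin (at scale `M`) that contains `x`. -/
def shellIndex (M : ℝ) (x : Fin d → ℝ) : ℕ := Nat.size ⌊‖x‖ / M⌋₊

@[fun_prop]
lemma measurable_shellIndex (M : ℝ) : Measurable (shellIndex M : (Fin d → ℝ) → ℕ) :=
  (measurable_from_top (f := Nat.size)).comp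
    (Nat.measurable_floor.comp (measurable_norm.div_const M))

lemma norm_lt_of_shellIndex {M : ℝ} (hM : 0 < M) (x : Fin d → ℝ) :
    ‖x‖ < M * 2 ^ shellIndex M x := by
  have h := Nat.lt_size_self ⌊‖x‖ / M⌋₊
  have h2 : ‖x‖ / M < ((2 ^ shellIndex M x : ℕ) : ℝ) := (Nat.floor_lt (by positivity)).1 h
  rw [div_lt_iff₀ hM] at h2
  push_cast at h2
  linarith

lemma le_norm_of_shellIndex {M : ℝ} (hM : 0 < M) (x : Fin d → ℝ) {n : ℕ}
    (h : shellIndex M x = n + 1) : M * 2 ^ n ≤ ‖x‖ := by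
  have h1 : n < Nat.size ⌊‖x‖ / M⌋₊ := by rw [← shellIndex, h]; exact n.lt_succ_self
  rw [Nat.lt_size] at h1
  have h2 : ((2 ^ n : ℕ) : ℝ) ≤ ‖x‖ / M :=
    (Nat.cast_le.2 h1).trans (Nat.floor_le (by positivity))
  rw [le_div_iff₀ hM] at h2
  push_cast at h2
  linarith

lemma scale_shellIndex_le {M : ℝ} (hM : 0 < M) (x : Fin d → ℝ) :
    M * 2 ^ shellIndex M x ≤ M + 2 * ‖x‖ := by
  rcases h : shellIndex M x with _ | n
  · have := norm_nonneg x
    simp only [pow_zero]; linarith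
  · have := le_norm_of_shellIndex hM x h
    rw [pow_succ]; linarith

variable (M : ℝ) (L : ℕ → ℕ) (k : ℕ)

/-- The label of the cube of generation `min k (L n)` that contains `x`, where `n` is the index of
the shell of `x`. -/
def cubeLabel (x : Fin d → ℝ) : ℕ × (Fin d → ℤ) :=
  (shellIndex M x,
    fun i => ⌊(2 : ℝ) ^ min k (L (shellIndex M x)) * ((x i / (M * 2 ^ shellIndex M x) + 1) / 2)⌋)

/-- The centre of the cube with a given label. -/
def cubeCenter (j : ℕ × (Fin d → ℤ)) : Fin d → ℝ :=
  fun i => M * 2 ^ j.1 * ((2 * j.2 i + 1) / 2 ^ min k (L j.1) - 1)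

/-- The label of the cube of the previous generation. -/
def parentLabel (j : ℕ × (Fin d → ℤ)) : ℕ × (Fin d → ℤ) :=
  (j.1, fun i => if k < L j.1 then j.2 i / 2 else j.2 i)

@[fun_prop]
lemma measurable_cubeLabel : Measurable (cubeLabel M L k : (Fin d → ℝ) → ℕ × (Fin d → ℤ)) := by
  refine (measurable_shellIndex M).prodMk (measurable_pi_lambda _ fun i => ?_)
  refine Int.measurable_floor.comp ?_
  have h1 : Measurable fun x : Fin d → ℝ => (2 : ℝ) ^ min k (L (shellIndex M x)) :=
    (measurable_from_top (f := fun n : ℕ => (2 : ℝ) ^ min k (L n))).comp (measurable_shellIndex M)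
  have h2 : Measurable fun x : Fin d → ℝ => M * (2 : ℝ) ^ (shellIndex M x) :=
    (measurable_from_top (f := fun n : ℕ => M * (2 : ℝ) ^ n)).comp (measurable_shellIndex M)
  fun_prop

lemma measurable_cubeCenter : Measurable (cubeCenter M L k : ℕ × (Fin d → ℤ) → (Fin d → ℝ)) :=
  measurable_of_countable _

lemma measurable_parentLabel :
    Measurable (parentLabel L k : ℕ × (Fin d → ℤ) → ℕ × (Fin d → ℤ)) :=
  measurable_of_countable _

lemma parentLabel_cubeLabel (x : Fin d → ℝ) :
    parentLabel L k (cubeLabel M L (k + 1) x) = cubeLabel M L k x := by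
  refine Prod.ext rfl ?_
  funext i
  by_cases h : k < L (shellIndex M x)
  · refine (if_pos h).trans ?_
    simp only [cubeLabel]
    rw [min_eq_left (by omega : k + 1 ≤ _), min_eq_left h.le]
    have h2 := Int.floor_div_natCast
      ((2 : ℝ) ^ (k + 1) * ((x i / (M * 2 ^ shellIndex M x) + 1) / 2)) 2
    rw [Nat.cast_ofNat] at h2
    push_cast at h2
    rw [← h2]
    congr 1
    rw [pow_succ]; ring
  · refine (if_neg h).trans ?_
    simp only [cubeLabel]
    rw [min_eq_right (by omega), min_eq_right (by omega)]

variable {M}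

/-- The bound is half the side length of the cube. -/
lemma norm_sub_cubeCenter_le (hM : 0 < M) (x : Fin d → ℝ) :
    ‖x - cubeCenter M L k (cubeLabel M L k x)‖ ≤
      M * 2 ^ shellIndex M x / 2 ^ min k (L (shellIndex M x)) := by
  rw [pi_norm_le_iff_of_nonneg (by positivity)]
  intro i
  simp only [Pi.sub_apply, cubeCenter, cubeLabel, Real.norm_eq_abs]
  set R := M * 2 ^ shellIndex M x with hR
  have hRpos : 0 < R := by positivity
  set s : ℝ := 2 ^ min k (L (shellIndex M x)) with hs
  have hspos : 0 < s := by positivity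
  set y := s * ((x i / R + 1) / 2) with hy
  have e : x i - R * ((2 * (⌊y⌋ : ℝ) + 1) / s - 1) = R / s * (2 * (y - ⌊y⌋) - 1) := by
    rw [hy]; field_simp; ring
  rw [e, abs_mul, abs_of_pos (by positivity : 0 < R / s)]
  have h1 := Int.floor_le y
  have h2 := Int.lt_floor_add_one y
  have : |2 * (y - ⌊y⌋) - 1| ≤ 1 := by rw [abs_le]; constructor <;> linarith
  exact mul_le_of_le_one_right (by positivity) this

lemma norm_cubeCenter_sub_parent_le (hM : 0 < M) (j : ℕ × (Fin d → ℤ)) :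
    ‖cubeCenter M L (k + 1) j - cubeCenter M L k (parentLabel L k j)‖ ≤
      if k < L j.1 then M * 2 ^ j.1 / 2 ^ (k + 1) else 0 := by
  split_ifs with h
  · rw [pi_norm_le_iff_of_nonneg (by positivity)]
    intro i
    simp only [Pi.sub_apply, cubeCenter, parentLabel, if_pos h, Real.norm_eq_abs]
    rw [min_eq_left (by omega : k + 1 ≤ _), min_eq_left h.le]
    have e : M * 2 ^ j.1 * ((2 * (j.2 i : ℝ) + 1) / 2 ^ (k + 1) - 1) -
        M * 2 ^ j.1 * ((2 * ((j.2 i / 2 : ℤ) : ℝ) + 1) / 2 ^ k - 1) =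
        M * 2 ^ j.1 / 2 ^ (k + 1) * (2 * (j.2 i - 2 * ((j.2 i / 2 : ℤ) : ℝ)) - 1) := by
      rw [pow_succ]; field_simp; ring
    rw [e, abs_mul, abs_of_pos (by positivity : 0 < M * 2 ^ j.1 / 2 ^ (k + 1))]
    have h3 : j.2 i - 2 * (j.2 i / 2) = 0 ∨ j.2 i - 2 * (j.2 i / 2) = 1 := by omega
    have : |2 * ((j.2 i : ℝ) - 2 * ((j.2 i / 2 : ℤ) : ℝ)) - 1| ≤ 1 := by
      rcases h3 with h3 | h3
      · have : (j.2 i : ℝ) - 2 * ((j.2 i / 2 : ℤ) : ℝ) = 0 := by exact_mod_cast h3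
        rw [this]; norm_num
      · have : (j.2 i : ℝ) - 2 * ((j.2 i / 2 : ℤ) : ℝ) = 1 := by exact_mod_cast h3
        rw [this]; norm_num
    exact mul_le_of_le_one_right (by positivity) this
  · refine le_of_eq ?_
    rw [norm_eq_zero, sub_eq_zero]
    funext i
    simp only [cubeCenter, parentLabel, if_neg h]
    rw [min_eq_right (by omega), min_eq_right (by omega)]

lemma lintegral_cubeCenter_ne_top (hM : 0 < M) (a : Measure (Fin d → ℝ)) [IsFiniteMeasure a]
    (ha : ∫⁻ x, ENNReal.ofReal ‖x‖ ∂a ≠ ∞) :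
    ∫⁻ x, ENNReal.ofReal (nrm (cubeCenter M L k (cubeLabel M L k x))) ∂a ≠ ∞ := by
  have hD := cubeDiam_nonneg nrm
  have h : ∀ x : Fin d → ℝ, ENNReal.ofReal (nrm (cubeCenter M L k (cubeLabel M L k x))) ≤
      ENNReal.ofReal (cubeDiam nrm) * (ENNReal.ofReal M + 3 * ENNReal.ofReal ‖x‖) := by
    intro x
    have h1 : ‖cubeCenter M L k (cubeLabel M L k x)‖ ≤ M + 3 * ‖x‖ := by
      have h2 := norm_sub_cubeCenter_le (M := M) L k hM x
      have h3 : M * 2 ^ shellIndex M x / 2 ^ min k (L (shellIndex M x)) ≤ M + 2 * ‖x‖ :=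
        (div_le_self (by positivity) (one_le_pow₀ one_le_two)).trans (scale_shellIndex_le hM x)
      have h4 := norm_sub_norm_le (cubeCenter M L k (cubeLabel M L k x)) x
      rw [norm_sub_rev] at h4
      linarith
    have e : (3 : ℝ≥0∞) = ENNReal.ofReal 3 := by simp
    rw [e, ← ENNReal.ofReal_mul (by norm_num), ← ENNReal.ofReal_add hM.le (by positivity),
      ← ENNReal.ofReal_mul hD]
    exact ENNReal.ofReal_le_ofReal ((seminorm_le_cubeDiam_mul nrm _).trans (by gcongr))
  refine ne_top_of_le_ne_top ?_ (lintegral_mono h)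
  rw [lintegral_const_mul _ (by fun_prop), lintegral_add_left measurable_const, lintegral_const,
    lintegral_const_mul _ (by fun_prop)]
  finiteness

/-- Telescoping over generations by `transportCost_map_le_add`, comparing each centre with the
centre of its parent. Shells whose final generation is reached contribute nothing more. -/
lemma transportCost_map_cubeCenter_le (hM : 0 < M) (a b : Measure (Fin d → ℝ))
    [IsProbabilityMeasure a] [IsProbabilityMeasure b] (ha : ∫⁻ x, ENNReal.ofReal ‖x‖ ∂a ≠ ∞)
    (hb : ∫⁻ x, ENNReal.ofReal ‖x‖ ∂b ≠ ∞) (K : ℕ) :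
    transportCost nrm ((a.map (cubeLabel M L K)).map (cubeCenter M L K))
        ((b.map (cubeLabel M L K)).map (cubeCenter M L K)) ≤
      ∑ k ∈ Finset.range K, ∑' j : ℕ × (Fin d → ℤ),
        (if k < L j.1 then ENNReal.ofReal (cubeDiam nrm * (M * 2 ^ j.1 / 2 ^ (k + 1))) else 0) *
          ENNReal.ofReal |b.real (cubeLabel M L (k + 1) ⁻¹' {j}) -
            a.real (cubeLabel M L (k + 1) ⁻¹' {j})| := by
  induction K with
  | zero =>
    -- At generation 0 the centre is the origin for every shell, so mass moved between different
    -- shells needs no separate treatment.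
    have : ∀ x : Fin d → ℝ, cubeCenter M L 0 (cubeLabel M L 0 x) = 0 := by
      intro x
      funext i
      have h1 := norm_lt_of_shellIndex hM x
      set R := M * 2 ^ shellIndex M x with hR
      have hRpos : 0 < R := by positivity
      have h2 := (norm_le_pi_norm x i).trans_lt h1
      rw [Real.norm_eq_abs, abs_lt] at h2
      have h3 : ⌊(x i / R + 1) / 2⌋ = 0 := by
        rw [Int.floor_eq_zero_iff]
        have h4 : -1 < x i / R := by rw [lt_div_iff₀ hRpos]; linarith
        have h5 : x i / R < 1 := by rw [div_lt_iff₀ hRpos]; linarith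
        constructor <;> linarith
      simp [cubeCenter, cubeLabel, ← hR, h3]
    have e : ∀ a : Measure (Fin d → ℝ), (a.map (cubeLabel M L 0)).map (cubeCenter M L 0) =
        a.map fun _ => 0 := by
      intro a
      rw [Measure.map_map (measurable_cubeCenter M L 0) (measurable_cubeLabel M L 0)]
      exact congrArg (fun f => a.map f) (funext this)
    rw [e, e, Measure.map_const, Measure.map_const, measure_univ, measure_univ,
      transportCost_self]
    exact bot_le
  | succ k ih =>
    rw [Finset.sum_range_succ]
    have ml := measurable_cubeLabel (d := d) M L
    have mc := measurable_cubeCenter (d := d) M L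
    have mp := measurable_parentLabel (d := d) L k
    have pa : IsProbabilityMeasure (a.map (cubeLabel M L (k + 1))) :=
      Measure.isProbabilityMeasure_map (ml _).aemeasurable
    have pb : IsProbabilityMeasure (b.map (cubeLabel M L (k + 1))) :=
      Measure.isProbabilityMeasure_map (ml _).aemeasurable
    have fin : ∀ a : Measure (Fin d → ℝ), IsProbabilityMeasure a →
        ∫⁻ x, ENNReal.ofReal ‖x‖ ∂a ≠ ∞ →
        ∫⁻ j, ENNReal.ofReal (nrm ((cubeCenter M L k ∘ parentLabel L k) j))
          ∂(a.map (cubeLabel M L (k + 1))) ≠ ∞ := by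
      intro a _ ha
      rw [lintegral_map (measurable_of_countable _) (ml _)]
      simp only [Function.comp_apply, parentLabel_cubeLabel]
      exact lintegral_cubeCenter_ne_top L k hM a ha
    have ecomp : ∀ a : Measure (Fin d → ℝ),
        (a.map (cubeLabel M L (k + 1))).map (cubeCenter M L k ∘ parentLabel L k) =
        (a.map (cubeLabel M L k)).map (cubeCenter M L k) := by
      intro a
      rw [Measure.map_map ((mc k).comp mp) (ml _), Measure.map_map (mc k) (ml _)]
      congr 1
      funext x
      simp only [Function.comp_apply, parentLabel_cubeLabel]
    refine (transportCost_map_le_add (nrm := nrm) _ _ (mc (k + 1)) ((mc k).comp mp)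
      (fin a inferInstance ha) (fin b inferInstance hb)).trans ?_
    rw [ecomp, ecomp]
    refine add_le_add ih ?_
    rw [lintegral_countable']
    refine ENNReal.tsum_le_tsum fun j => ?_
    rw [Measure.add_apply, sub_apply_add_sub_apply_singleton, abs_sub_comm]
    rw [map_measureReal_apply (ml _) (measurableSet_singleton j),
      map_measureReal_apply (ml _) (measurableSet_singleton j)]
    gcongr
    refine (ENNReal.ofReal_le_ofReal ((seminorm_le_cubeDiam_mul nrm _).trans
      (mul_le_mul_of_nonneg_left (norm_cubeCenter_sub_parent_le L k hM j)
        (cubeDiam_nonneg nrm)))).trans ?_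
    split_ifs <;> simp

end Refinement

/-! ### Mean error as a sum over shells. -/

section Pierce

variable {d : ℕ} {nrm : Seminorm ℝ (Fin d → ℝ)} {M : ℝ} (L : ℕ → ℕ) (k : ℕ)

lemma cubeLabel_mem_box (hM : 0 < M) (x : Fin d → ℝ) (h : k ≤ L (shellIndex M x)) :
    (cubeLabel M L k x).2 ∈ Fintype.piFinset fun _ : Fin d => Finset.Ico (0 : ℤ) (2 ^ k) := by
  rw [Fintype.mem_piFinset]
  intro i
  have h1 := norm_lt_of_shellIndex hM x
  have h2 := (norm_le_pi_norm x i).trans_lt h1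
  simp only [cubeLabel, min_eq_left h]
  set R := M * 2 ^ shellIndex M x with hR
  have hRpos : 0 < R := by positivity
  rw [Real.norm_eq_abs, abs_lt] at h2
  have h4 : -1 < x i / R := by rw [lt_div_iff₀ hRpos]; linarith
  have h5 : x i / R < 1 := by rw [div_lt_iff₀ hRpos]; linarith
  have h6 : (0 : ℝ) < 2 ^ k := by positivity
  rw [Finset.mem_Ico]
  constructor
  · exact Int.floor_nonneg.2 (mul_nonneg h6.le (by linarith))
  · rw [Int.floor_lt]
    push_cast
    have : (x i / R + 1) / 2 < 1 := by linarith
    nlinarith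

/-- Cauchy–Schwarz. -/
lemma sum_sqrt_le {ι : Type*} (S : Finset ι) (f : ι → ℝ≥0∞) :
    ∑ i ∈ S, f i ^ (1 / 2 : ℝ) ≤ (S.card * ∑ i ∈ S, f i) ^ (1 / 2 : ℝ) := by
  have h := ENNReal.rpow_sum_le_const_mul_sum_rpow S (fun i => f i ^ (1 / 2 : ℝ))
    (p := 2) one_le_two
  have e : ∀ i, (f i ^ (1 / 2 : ℝ)) ^ (2 : ℝ) = f i := fun i => by
    rw [← ENNReal.rpow_mul]; norm_num
  simp only [e] at h
  norm_num at h
  calc ∑ i ∈ S, f i ^ (1 / 2 : ℝ) = ((∑ i ∈ S, f i ^ (1 / 2 : ℝ)) ^ (2 : ℝ)) ^ (1 / 2 : ℝ) := by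
        rw [← ENNReal.rpow_mul]; norm_num
    _ ≤ _ := by
        refine ENNReal.rpow_le_rpow ?_ (by norm_num)
        simpa using h

/-- The total mean deviation of the frequencies of the cubes of generation `k` of one shell. -/
lemma tsum_sqrt_cubeLabel_le (hM : 0 < M) (μ : Measure (Fin d → ℝ)) (c : ℝ≥0∞) (n : ℕ)
    (h : k ≤ L n) :
    ∑' z : Fin d → ℤ, (μ (cubeLabel M L k ⁻¹' {(n, z)}) * c) ^ (1 / 2 : ℝ) ≤
      (2 ^ (k * d) * (μ (shellIndex M ⁻¹' {n}) * c)) ^ (1 / 2 : ℝ) := by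
  set S := Fintype.piFinset fun _ : Fin d => Finset.Ico (0 : ℤ) (2 ^ k) with hS
  have hcard : (S.card : ℝ≥0∞) = 2 ^ (k * d) := by
    rw [hS, Fintype.card_piFinset]
    have : ((2 : ℤ) ^ k).toNat = 2 ^ k := by
      rw [show (2 : ℤ) ^ k = ((2 ^ k : ℕ) : ℤ) by push_cast; rfl, Int.toNat_natCast]
    simp [pow_mul, this]
  have hempty : ∀ z ∉ S, (μ (cubeLabel M L k ⁻¹' {(n, z)}) * c) ^ (1 / 2 : ℝ) = 0 := by
    intro z hz
    have : cubeLabel M L k ⁻¹' {(n, z)} = ∅ := by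
      rw [Set.eq_empty_iff_forall_notMem]
      intro x hx
      have hx' : cubeLabel M L k x = (n, z) := hx
      have hn : shellIndex M x = n := congrArg Prod.fst hx'
      refine hz ?_
      have := cubeLabel_mem_box L k hM x (hn ▸ h)
      rwa [hx'] at this
    rw [this]
    simp
  rw [tsum_eq_sum hempty]
  refine (sum_sqrt_le S _).trans (ENNReal.rpow_le_rpow ?_ (by norm_num))
  rw [hcard, ← Finset.sum_mul]
  gcongr
  rw [← measure_biUnion_finset]
  · refine measure_mono ?_
    simp only [Set.iUnion_subset_iff]
    intro z _ x hx
    exact congrArg Prod.fst (hx : cubeLabel M L k x = (n, z))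
  · intro z _ z' _ hzz
    refine Set.disjoint_left.2 fun x hx hx' => hzz ?_
    have h1 : cubeLabel M L k x = (n, z) := hx
    have h2 : cubeLabel M L k x = (n, z') := hx'
    exact congrArg Prod.snd (h1.symm.trans h2)
  · intro z _
    exact measurable_cubeLabel M L k (measurableSet_singleton _)

lemma lintegral_norm_empirical_ne_top {N : ℕ} (hN : 1 ≤ N) (x : Fin N → (Fin d → ℝ))
    {φ : (Fin d → ℝ) → ℝ≥0∞} (hφ : ∀ y, φ y ≠ ∞) : ∫⁻ y, φ y ∂(empirical x) ≠ ∞ := by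
  have hN0 : (N : ℝ≥0∞) ≠ 0 := by exact_mod_cast (by omega : N ≠ 0)
  rw [lintegral_empirical]
  exact ENNReal.mul_ne_top (ENNReal.inv_ne_top.2 hN0) (ENNReal.sum_ne_top.2 fun i _ => hφ _)

/-- The factor 2 counts two discretisation errors, that of `μ` and that of the sample, whose
expectation equals the former. The inner sum is the chaining cost, with the mean deviation of each
frequency replaced by its variance bound. The uniform bound `K` lets one finite chain serve all
shells. -/
lemma randError_le_tsum_shells (hM : 0 < M) (μ : Measure (Fin d → ℝ)) [IsProbabilityMeasure μ]
    (hμ : ∫⁻ x, ENNReal.ofReal ‖x‖ ∂μ ≠ ∞) {N : ℕ} (hN : 1 ≤ N) {K : ℕ} (hK : ∀ n, L n ≤ K) :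
    randError nrm 1 N μ ≤ ∑' n : ℕ, ENNReal.ofReal (cubeDiam nrm * (M * 2 ^ n)) *
      (2 * (2 ^ L n)⁻¹ * μ (shellIndex M ⁻¹' {n}) + ∑ k ∈ Finset.range (L n), (2 ^ (k + 1))⁻¹ *
        (2 ^ ((k + 1) * d) * (μ (shellIndex M ⁻¹' {n}) * (N : ℝ≥0∞)⁻¹)) ^ (1 / 2 : ℝ)) := by
  have hD := cubeDiam_nonneg nrm
  have hdiv : ∀ (n l : ℕ), ENNReal.ofReal (cubeDiam nrm * (M * 2 ^ n / 2 ^ l)) =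
      ENNReal.ofReal (cubeDiam nrm * (M * 2 ^ n)) * (2 ^ l)⁻¹ := by
    intro n l
    rw [← mul_div_assoc, ENNReal.ofReal_div_of_pos (by positivity), div_eq_mul_inv]
    congr 2
    rw [ENNReal.ofReal_pow (by norm_num)]
    simp
  set c : (Fin d → ℝ) → (Fin d → ℝ) := fun x => cubeCenter M L K (cubeLabel M L K x) with hc
  have ml := measurable_cubeLabel (d := d) M L
  have mcc := measurable_cubeCenter (d := d) M L
  have mc : Measurable c := (mcc K).comp (ml K)
  set ψ : (Fin d → ℝ) → ℝ≥0∞ := fun x => ENNReal.ofReal (nrm (x - c x)) with hψ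
  have mψ : Measurable ψ := by fun_prop
  have emap : ∀ a : Measure (Fin d → ℝ),
      (a.map (cubeLabel M L K)).map (cubeCenter M L K) = a.map c := fun a =>
    Measure.map_map (mcc K) (ml K)
  set w : ℕ → ℕ → ℝ≥0∞ := fun k n =>
    if k < L n then ENNReal.ofReal (cubeDiam nrm * (M * 2 ^ n / 2 ^ (k + 1))) else 0 with hw
  have pointwise : ∀ x : Fin N → (Fin d → ℝ), transportCost nrm μ (empirical x) ≤
      ∫⁻ y, ψ y ∂μ + (N : ℝ≥0∞)⁻¹ * ∑ i, ψ (x i) +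
      ∑ k ∈ Finset.range K, ∑' j : ℕ × (Fin d → ℤ), w k j.1 *
          ENNReal.ofReal |(N : ℝ)⁻¹ * ∑ i, (cubeLabel M L (k + 1) ⁻¹' {j}).indicator
            (fun _ => (1 : ℝ)) (x i) - μ.real (cubeLabel M L (k + 1) ⁻¹' {j})| := by
    intro x
    have px := isProbabilityMeasure_empirical hN x
    have h1 : ∀ a : Measure (Fin d → ℝ), transportCost nrm a (a.map c) ≤ ∫⁻ y, ψ y ∂a := by
      intro a
      simpa using transportCost_map_map (nrm := nrm) a measurable_id mc
    have h2 := transportCost_map_cubeCenter_le (nrm := nrm) L hM μ (empirical x) hμ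
      (lintegral_norm_empirical_ne_top hN x fun _ => ENNReal.ofReal_ne_top) K
    rw [emap, emap] at h2
    simp only [empirical_real_apply x (ml _ (measurableSet_singleton _))] at h2
    have f1 : IsFiniteMeasure (μ.map c) := inferInstance
    have f2 : IsFiniteMeasure ((empirical x).map c) := inferInstance
    calc transportCost nrm μ (empirical x)
        ≤ transportCost nrm μ (μ.map c) + (transportCost nrm (μ.map c) ((empirical x).map c) +
          transportCost nrm ((empirical x).map c) (empirical x)) :=
        (transportCost_triangle _ (μ.map c) _).trans
          (by gcongr; exact transportCost_triangle _ ((empirical x).map c) _)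
      _ ≤ ∫⁻ y, ψ y ∂μ + (_ + ∫⁻ y, ψ y ∂(empirical x)) := by
        refine add_le_add (h1 μ) (add_le_add h2 ?_)
        rw [transportCost_comm]
        exact h1 _
      _ = _ := by rw [lintegral_empirical]; ring
  have dev : ∀ k, ∀ j : ℕ × (Fin d → ℤ), Measurable fun x : Fin N → (Fin d → ℝ) =>
      w k j.1 * ENNReal.ofReal |(N : ℝ)⁻¹ * ∑ i, (cubeLabel M L (k + 1) ⁻¹' {j}).indicator
            (fun _ => (1 : ℝ)) (x i) - μ.real (cubeLabel M L (k + 1) ⁻¹' {j})| := by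
    intro k j
    have : Measurable ((cubeLabel M L (k + 1) ⁻¹' {j}).indicator (fun _ => (1 : ℝ))) :=
      measurable_const.indicator (ml _ (measurableSet_singleton _))
    fun_prop
  have hmean : ∫⁻ y, ψ y ∂μ ≤ ∑' n : ℕ, ENNReal.ofReal (cubeDiam nrm * (M * 2 ^ n)) *
      ((2 ^ L n)⁻¹ * μ (shellIndex M ⁻¹' {n})) := by
    calc ∫⁻ y, ψ y ∂μ ≤ ∫⁻ y, ENNReal.ofReal (cubeDiam nrm *
          (M * 2 ^ shellIndex M y / 2 ^ L (shellIndex M y))) ∂μ := by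
          refine lintegral_mono fun y => ENNReal.ofReal_le_ofReal ?_
          have := norm_sub_cubeCenter_le L K hM y
          rw [min_eq_right (hK _)] at this
          exact (seminorm_le_cubeDiam_mul nrm _).trans (by gcongr)
      _ = ∫⁻ n, ENNReal.ofReal (cubeDiam nrm * (M * 2 ^ n / 2 ^ L n)) ∂(μ.map (shellIndex M)) := by
          rw [lintegral_map measurable_from_top (measurable_shellIndex M)]
      _ = _ := by
          rw [lintegral_countable']
          refine tsum_congr fun n => ?_
          rw [hdiv, Measure.map_apply (measurable_shellIndex M) (measurableSet_singleton _),
            mul_assoc]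
  have hdev : ∀ k, ∑' j : ℕ × (Fin d → ℤ), ∫⁻ x, w k j.1 *
      ENNReal.ofReal |(N : ℝ)⁻¹ * ∑ i, (cubeLabel M L (k + 1) ⁻¹' {j}).indicator
            (fun _ => (1 : ℝ)) (x i) - μ.real (cubeLabel M L (k + 1) ⁻¹' {j})|
        ∂(Measure.pi fun _ : Fin N => μ) ≤
      ∑' n : ℕ, if k < L n then ENNReal.ofReal (cubeDiam nrm * (M * 2 ^ n)) * ((2 ^ (k + 1))⁻¹ *
        (2 ^ ((k + 1) * d) * (μ (shellIndex M ⁻¹' {n}) * (N : ℝ≥0∞)⁻¹)) ^ (1 / 2 : ℝ)) else 0 := by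
    intro k
    have h1 : ∀ j : ℕ × (Fin d → ℤ), ∫⁻ x, w k j.1 *
      ENNReal.ofReal |(N : ℝ)⁻¹ * ∑ i, (cubeLabel M L (k + 1) ⁻¹' {j}).indicator
            (fun _ => (1 : ℝ)) (x i) - μ.real (cubeLabel M L (k + 1) ⁻¹' {j})|
        ∂(Measure.pi fun _ : Fin N => μ) ≤
        w k j.1 * (μ (cubeLabel M L (k + 1) ⁻¹' {j}) * (N : ℝ≥0∞)⁻¹) ^ (1 / 2 : ℝ) := by
      intro j
      have wt : w k j.1 ≠ ∞ := by
        simp only [hw]; split_ifs <;> simp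
      rw [lintegral_const_mul' _ _ wt, ← div_eq_mul_inv]
      gcongr
      exact lintegral_abs_frequency_sub_le μ hN (ml _ (measurableSet_singleton _))
    refine (ENNReal.tsum_le_tsum h1).trans ?_
    rw [ENNReal.tsum_prod']
    refine ENNReal.tsum_le_tsum fun n => ?_
    simp only [hw]
    split_ifs with h
    · rw [ENNReal.tsum_mul_left, hdiv, mul_assoc]
      gcongr
      exact tsum_sqrt_cubeLabel_le L (k + 1) hM μ _ n h
    · simp
  rw [randError_one]
  refine (lintegral_mono pointwise).trans ?_
  rw [lintegral_add_left (by fun_prop), lintegral_add_left measurable_const, lintegral_const,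
    measure_univ, mul_one, lintegral_pi_average μ hN mψ, lintegral_finsetSum _ fun k _ =>
      Measurable.tsum fun j => dev k j]
  simp only [lintegral_tsum fun j => (dev _ j).aemeasurable]
  refine (add_le_add (add_le_add hmean hmean) (Finset.sum_le_sum fun k _ => hdev k)).trans ?_
  rw [← Summable.tsum_finsetSum fun _ _ => ENNReal.summable, ← ENNReal.tsum_add,
    ← ENNReal.tsum_add]
  refine ENNReal.tsum_le_tsum fun n => le_of_eq ?_
  have hfil : (Finset.range K).filter (fun k => k < L n) = Finset.range (L n) := by
    ext k
    have := hK n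
    simp only [Finset.mem_filter, Finset.mem_range]
    omega
  rw [← Finset.sum_filter, hfil, ← Finset.mul_sum]
  ring

end Pierce

/-! ### Admissible constants and the optimal Pierce constant. -/

section PierceConstant

lemma sum_pow_le {r : ℝ} (hr : 1 < r) (L : ℕ) :
    ∑ k ∈ Finset.range L, r ^ (k + 1) ≤ r ^ L * (1 / (1 - r⁻¹)) := by
  have hr0 : 0 < r := by linarith
  have h1 : 0 < r - 1 := by linarith
  have e : 1 / (1 - r⁻¹) = r / (r - 1) := by field_simp
  simp only [pow_succ]
  rw [← Finset.sum_mul, geom_sum_eq hr.ne', e, div_mul_eq_mul_div, mul_div_assoc']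
  gcongr
  linarith

/-- The contribution of one shell of mass `p`, when its cubes are refined down to mass `1 / N`. -/
lemma shell_contribution_le {d : ℕ} (hd : 3 ≤ d) {N : ℕ} (hN : 1 ≤ N) {p : ℝ} (hp : 0 ≤ p) :
    2 * (2 ^ Nat.log (2 ^ d) ⌊N * p⌋₊)⁻¹ * p +
      ∑ k ∈ Finset.range (Nat.log (2 ^ d) ⌊N * p⌋₊),
        (2 ^ (k + 1))⁻¹ * (2 ^ ((k + 1) * d) * (p * (N : ℝ)⁻¹)) ^ (1 / 2 : ℝ) ≤
    (4 + 1 / (1 - 2 ^ (1 - (d : ℝ) / 2))) * (N : ℝ) ^ (-(1 / (d : ℝ))) * p ^ (1 - 1 / (d : ℝ)) := by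
  have hdR : (3 : ℝ) ≤ d := by exact_mod_cast hd
  have hd0 : (d : ℝ) ≠ 0 := by linarith
  have hd1 : 1 / (d : ℝ) ≤ 1 / 3 := by gcongr
  have hNR : (1 : ℝ) ≤ N := by exact_mod_cast hN
  have hN0 : (0 : ℝ) < N := by linarith
  have hr : (2 : ℝ) ^ (1 - (d : ℝ) / 2) < 1 :=
    Real.rpow_lt_one_of_one_lt_of_neg one_lt_two (by linarith)
  have hS : 0 < 1 - (2 : ℝ) ^ (1 - (d : ℝ) / 2) := by linarith
  rcases hp.eq_or_lt with rfl | hp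
  · have h1 : (1 : ℝ) / 2 ≠ 0 := by norm_num
    have h2 : 0 ≤ (4 + 1 / (1 - (2 : ℝ) ^ (1 - (d : ℝ) / 2))) * (N : ℝ) ^ (-(1 / (d : ℝ))) *
      0 ^ (1 - 1 / (d : ℝ)) := by positivity
    simpa [Real.zero_rpow h1] using h2
  -- The stopping level balances the two terms: `2 ^ (d * L) ≤ N * p < 2 ^ (d * (L + 1))`, where the
  -- lower bound requires `N * p ≥ 1`.
  set L := Nat.log (2 ^ d) ⌊N * p⌋₊ with hL
  have hNp : 0 < N * p := by positivity
  set y : ℝ := (N * p) ^ (1 / (d : ℝ)) with hy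
  have hy0 : 0 < y := by positivity
  have hRHS : (N : ℝ) ^ (-(1 / (d : ℝ))) * p ^ (1 - 1 / (d : ℝ)) = p / y := by
    rw [hy, Real.mul_rpow hN0.le hp.le, Real.rpow_neg hN0.le, Real.rpow_sub hp, Real.rpow_one]
    field_simp
  have hroot : ∀ m : ℕ, (((2 ^ d) ^ m : ℕ) : ℝ) ^ (1 / (d : ℝ)) = 2 ^ m := by
    intro m
    push_cast
    rw [← pow_mul, mul_comm, pow_mul, one_div, Real.pow_rpow_inv_natCast (by positivity) (by omega)]
  have hA : y ≤ 2 * 2 ^ L := by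
    have h1 : ⌊N * p⌋₊ < (2 ^ d) ^ (L + 1) :=
      Nat.lt_pow_succ_log_self (Nat.one_lt_pow (by omega) one_lt_two) _
    have h2 := Real.rpow_le_rpow hNp.le (Nat.lt_of_floor_lt h1).le
      (by positivity : 0 ≤ 1 / (d : ℝ))
    rw [hroot] at h2
    rw [pow_succ] at h2
    linarith
  have hfirst : 2 * (2 ^ L)⁻¹ * p ≤ 4 * (p / y) := by
    have h1 : (2 ^ L)⁻¹ ≤ 2 / y := by
      rw [inv_le_comm₀ (by positivity) (by positivity), inv_div, div_le_iff₀ two_pos]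
      linarith
    calc 2 * (2 ^ L)⁻¹ * p ≤ 2 * (2 / y) * p := by gcongr
      _ = _ := by ring
  -- The ratio exceeds 1 because `d ≥ 3`, so the last generation dominates the geometric sum.
  set r : ℝ := 2 ^ ((d : ℝ) / 2 - 1) with hrdef
  have hr1 : 1 < r := Real.one_lt_rpow one_lt_two (by linarith)
  have hrinv : r⁻¹ = 2 ^ (1 - (d : ℝ) / 2) := by
    rw [hrdef, ← Real.rpow_neg two_pos.le]; congr 1; ring
  have hterm : ∀ k : ℕ, ((2 : ℝ) ^ (k + 1))⁻¹ * (2 ^ ((k + 1) * d) * (p * (N : ℝ)⁻¹)) ^ (1 / 2 : ℝ) =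
      r ^ (k + 1) * (p * (N : ℝ)⁻¹) ^ (1 / 2 : ℝ) := by
    intro k
    rw [Real.mul_rpow (by positivity) (by positivity), ← mul_assoc]
    congr 1
    have h1 : ((2 : ℝ) ^ ((k + 1) * d)) ^ (1 / 2 : ℝ) = (2 ^ ((d : ℝ) / 2)) ^ (k + 1) := by
      rw [← Real.rpow_natCast, ← Real.rpow_natCast, ← Real.rpow_mul two_pos.le,
        ← Real.rpow_mul two_pos.le]
      congr 1
      push_cast; ring
    rw [h1, hrdef, Real.rpow_sub two_pos, Real.rpow_one, div_pow]
    ring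
  have hsecond : ∑ k ∈ Finset.range L,
        ((2 : ℝ) ^ (k + 1))⁻¹ * (2 ^ ((k + 1) * d) * (p * (N : ℝ)⁻¹)) ^ (1 / 2 : ℝ) ≤
      1 / (1 - 2 ^ (1 - (d : ℝ) / 2)) * (p / y) := by
    simp only [hterm]
    rw [← Finset.sum_mul]
    -- The case `L = 0` covers `N * p < 1`, where `Nat.log` takes its default value and `2 ^ L ≤ y`
    -- fails; the sum is then empty.
    rcases Nat.eq_zero_or_pos L with h0 | hpos
    · rw [h0]; simp only [Finset.range_zero, Finset.sum_empty, zero_mul]; positivity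
    have hB : 2 ^ L ≤ y := by
      have hne : ⌊N * p⌋₊ ≠ 0 := by
        intro h; rw [hL, h] at hpos; simp at hpos
      have h1 : (((2 ^ d) ^ L : ℕ) : ℝ) ≤ N * p :=
        (Nat.cast_le.2 (Nat.pow_log_le_self _ hne)).trans (Nat.floor_le hNp.le)
      have h2 := Real.rpow_le_rpow (by positivity) h1 (by positivity : 0 ≤ 1 / (d : ℝ))
      rwa [hroot] at h2
    have hrL : r ^ L ≤ (N * p) ^ (1 / 2 : ℝ) / y := by
      have h1 : r ^ L = ((2 : ℝ) ^ L) ^ ((d : ℝ) / 2 - 1) := by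
        rw [hrdef, ← Real.rpow_natCast, ← Real.rpow_mul two_pos.le, ← Real.rpow_natCast,
          ← Real.rpow_mul two_pos.le, mul_comm]
      have h2 : (N * p) ^ (1 / 2 : ℝ) / y = y ^ ((d : ℝ) / 2 - 1) := by
        rw [Real.rpow_sub hy0, Real.rpow_one, hy, ← Real.rpow_mul hNp.le]
        congr 2
        field_simp
      rw [h1, h2]
      exact Real.rpow_le_rpow (by positivity) hB (by linarith)
    have hsq : (N * p) ^ (1 / 2 : ℝ) * (p * (N : ℝ)⁻¹) ^ (1 / 2 : ℝ) = p := by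
      rw [← Real.mul_rpow (by positivity) (by positivity), ← Real.sqrt_eq_rpow]
      rw [show N * p * (p * (N : ℝ)⁻¹) = p ^ 2 by field_simp, Real.sqrt_sq hp.le]
    calc (∑ k ∈ Finset.range L, r ^ (k + 1)) * (p * (N : ℝ)⁻¹) ^ (1 / 2 : ℝ)
        ≤ ((N * p) ^ (1 / 2 : ℝ) / y * (1 / (1 - r⁻¹))) * (p * (N : ℝ)⁻¹) ^ (1 / 2 : ℝ) := by
          have h3 : 0 ≤ 1 / (1 - r⁻¹) := by rw [hrinv]; positivity
          gcongr
          exact (sum_pow_le hr1 L).trans (by gcongr)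
      _ = 1 / (1 - r⁻¹) * ((N * p) ^ (1 / 2 : ℝ) * (p * (N : ℝ)⁻¹) ^ (1 / 2 : ℝ) / y) := by ring
      _ = _ := by rw [hsq, hrinv]
  refine (add_le_add hfirst hsecond).trans (le_of_eq ?_)
  rw [← hRHS]
  ring

/-- An admissible constant for the Pierce type estimate with `p = 1`. -/
def shellConst {d : ℕ} (nrm : Seminorm ℝ (Fin d → ℝ)) (q : ℝ) : ℝ :=
  cubeDiam nrm * (4 + 1 / (1 - 2 ^ (1 - (d : ℝ) / 2))) *
    (2 ^ (q * (1 - 1 / (d : ℝ))) / (1 - 2 ^ (1 - q * (1 - 1 / (d : ℝ)))))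

variable {d : ℕ} {nrm : Seminorm ℝ (Fin d → ℝ)}

/-- Markov's inequality, since shell `n + 1` lies outside radius `M * 2 ^ n`. For `n = 0` the bound
exceeds 1 and is trivial. -/
lemma shell_measureReal_le {M q : ℝ} (hM : 0 < M) (hq : 0 < q) (μ : Measure (Fin d → ℝ))
    [IsProbabilityMeasure μ] (hμ : maxMoment q μ ≤ ENNReal.ofReal (M ^ q)) (n : ℕ) :
    μ.real (shellIndex M ⁻¹' {n}) ≤ 2 ^ (q * (1 - n)) := by
  rcases n with _ | n
  · refine measureReal_le_one.trans ?_
    simpa using Real.one_le_rpow one_le_two hq.le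
  · have h1 : ENNReal.ofReal ((M * 2 ^ n) ^ q) * μ (shellIndex M ⁻¹' {n + 1}) ≤ maxMoment q μ := by
      have := mul_meas_ge_le_lintegral (μ := μ) (f := fun x : Fin d → ℝ => ENNReal.ofReal ‖x‖ ^ q)
        (by fun_prop) (ENNReal.ofReal ((M * 2 ^ n) ^ q))
      refine le_trans ?_ this
      gcongr
      intro x hx
      rw [Set.mem_ofPred_eq, ENNReal.ofReal_rpow_of_nonneg (norm_nonneg _) hq.le]
      exact ENNReal.ofReal_le_ofReal (Real.rpow_le_rpow (by positivity)
        (le_norm_of_shellIndex hM x hx) hq.le)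
    have h2 := h1.trans hμ
    rw [← ENNReal.ofReal_toReal (measure_ne_top μ _), ← ENNReal.ofReal_mul (by positivity),
      ENNReal.ofReal_le_ofReal_iff (by positivity), ← measureReal_def,
      Real.mul_rpow hM.le (by positivity), mul_assoc] at h2
    have h3 := (mul_le_iff_le_one_right (by positivity : 0 < M ^ q)).1 h2
    have h4 : ((2 : ℝ) ^ n) ^ q = 2 ^ (q * n) := by
      rw [← Real.rpow_natCast, ← Real.rpow_mul two_pos.le, mul_comm]
    rw [h4] at h3
    have h5 : q * (1 - ((n + 1 : ℕ) : ℝ)) = -(q * n) := by push_cast; ring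
    rw [h5, Real.rpow_neg two_pos.le, ← one_div, le_div_iff₀ (by positivity)]
    linarith

/-- The first inequality is what makes the series over shells converge. -/
lemma one_lt_exponent (hd : 3 ≤ d) {q : ℝ} (hq : (d : ℝ) / ((d : ℝ) - 1) < q) :
    1 < q * (1 - 1 / (d : ℝ)) ∧ 1 < q := by
  have hdR : (3 : ℝ) ≤ d := by exact_mod_cast hd
  rw [div_lt_iff₀ (by linarith)] at hq
  constructor
  · rw [one_sub_div (by linarith), mul_div_assoc', lt_div_iff₀ (by linarith)]
    linarith
  · by_contra! h
    nlinarith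

lemma lintegral_norm_ne_top {q : ℝ} (hq : 1 < q) (μ : Measure (Fin d → ℝ)) [IsFiniteMeasure μ]
    (hμ : maxMoment q μ ≠ ∞) : ∫⁻ x, ENNReal.ofReal ‖x‖ ∂μ ≠ ∞ := by
  have h : ∀ x : Fin d → ℝ, ENNReal.ofReal ‖x‖ ≤ 1 + ENNReal.ofReal ‖x‖ ^ q := by
    intro x
    rcases le_total (ENNReal.ofReal ‖x‖) 1 with h | h
    · exact h.trans le_self_add
    · exact (ENNReal.le_rpow_self_of_one_le h hq.le).trans le_add_self
  refine ne_top_of_le_ne_top ?_ (lintegral_mono h)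
  rw [lintegral_add_left measurable_const, lintegral_const]
  exact ENNReal.add_ne_top.2 ⟨by finiteness, hμ⟩

lemma randError_le_of_maxMoment_le (hd : 3 ≤ d) {q : ℝ} (hq : (d : ℝ) / ((d : ℝ) - 1) < q)
    {M : ℝ} (hM : 0 < M) (μ : Measure (Fin d → ℝ)) [IsProbabilityMeasure μ]
    (hμ : maxMoment q μ ≤ ENNReal.ofReal (M ^ q)) {N : ℕ} (hN : 1 ≤ N) :
    randError nrm 1 N μ ≤ ENNReal.ofReal (shellConst nrm q) * ENNReal.ofReal M *
      (N : ℝ≥0∞) ^ (-(1 / (d : ℝ))) := by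
  obtain ⟨hq', hq1⟩ := one_lt_exponent hd hq
  have hD := cubeDiam_nonneg nrm
  have hdR : (3 : ℝ) ≤ d := by exact_mod_cast hd
  have hd1 : 1 / (d : ℝ) ≤ 1 / 3 := by gcongr
  have hN0 : (0 : ℝ) < N := by exact_mod_cast hN
  set p : ℕ → ℝ := fun n => μ.real (shellIndex M ⁻¹' {n}) with hp
  have hp0 : ∀ n, 0 ≤ p n := fun n => measureReal_nonneg
  have hpμ : ∀ n, μ (shellIndex M ⁻¹' {n}) = ENNReal.ofReal (p n) := fun n => by
    rw [hp, ofReal_measureReal]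
  -- The depth adapts to the mass of each shell; it is bounded uniformly because that mass is at
  -- most 1.
  set L : ℕ → ℕ := fun n => Nat.log (2 ^ d) ⌊N * p n⌋₊ with hL
  have hK : ∀ n, L n ≤ Nat.log (2 ^ d) N := by
    intro n
    refine Nat.log_mono_right (Nat.floor_le_of_le ?_)
    exact mul_le_of_le_one_right hN0.le measureReal_le_one
  have hr : (2 : ℝ) ^ (1 - (d : ℝ) / 2) < 1 :=
    Real.rpow_lt_one_of_one_lt_of_neg one_lt_two (by linarith)
  have hS : 0 < 1 - (2 : ℝ) ^ (1 - (d : ℝ) / 2) := by linarith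
  set S : ℝ := 4 + 1 / (1 - 2 ^ (1 - (d : ℝ) / 2)) with hSdef
  have hS0 : 0 < S := by positivity
  set ρ : ℝ := 2 ^ (1 - q * (1 - 1 / (d : ℝ))) with hρ
  have hρ0 : 0 < ρ := by positivity
  have hρ1 : ρ < 1 := Real.rpow_lt_one_of_one_lt_of_neg one_lt_two (by linarith)
  refine (randError_le_tsum_shells (nrm := nrm) L hM μ
    (lintegral_norm_ne_top hq1 μ (ne_top_of_le_ne_top ENNReal.ofReal_ne_top hμ)) hN hK).trans ?_
  have hterm : ∀ n, ENNReal.ofReal (cubeDiam nrm * (M * 2 ^ n)) *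
      (2 * (2 ^ L n)⁻¹ * μ (shellIndex M ⁻¹' {n}) + ∑ k ∈ Finset.range (L n), (2 ^ (k + 1))⁻¹ *
        (2 ^ ((k + 1) * d) * (μ (shellIndex M ⁻¹' {n}) * (N : ℝ≥0∞)⁻¹)) ^ (1 / 2 : ℝ)) ≤
      ENNReal.ofReal (cubeDiam nrm * S * 2 ^ (q * (1 - 1 / (d : ℝ))) * M *
        (N : ℝ) ^ (-(1 / (d : ℝ))) * ρ ^ n) := by
    intro n
    have two_pow : ∀ k : ℕ, (2 : ℝ≥0∞) ^ k = ENNReal.ofReal (2 ^ k) := fun k => by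
      rw [ENNReal.ofReal_pow two_pos.le]; simp
    have two_inv : ∀ k : ℕ, ((2 : ℝ≥0∞) ^ k)⁻¹ = ENNReal.ofReal ((2 ^ k)⁻¹) := fun k => by
      rw [ENNReal.ofReal_inv_of_pos (by positivity), two_pow]
    have N_inv : (N : ℝ≥0∞)⁻¹ = ENNReal.ofReal ((N : ℝ)⁻¹) := by
      rw [ENNReal.ofReal_inv_of_pos hN0, ENNReal.ofReal_natCast]
    have e : 2 * (2 ^ L n)⁻¹ * μ (shellIndex M ⁻¹' {n}) + ∑ k ∈ Finset.range (L n), (2 ^ (k + 1))⁻¹ *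
        (2 ^ ((k + 1) * d) * (μ (shellIndex M ⁻¹' {n}) * (N : ℝ≥0∞)⁻¹)) ^ (1 / 2 : ℝ) =
        ENNReal.ofReal (2 * (2 ^ L n)⁻¹ * p n + ∑ k ∈ Finset.range (L n),
          (2 ^ (k + 1))⁻¹ * (2 ^ ((k + 1) * d) * (p n * (N : ℝ)⁻¹)) ^ (1 / 2 : ℝ)) := by
      have hp0n := hp0 n
      rw [ENNReal.ofReal_add (by positivity) (by positivity),
        ENNReal.ofReal_sum_of_nonneg fun k _ => by positivity, hpμ, two_inv, N_inv,
        ENNReal.ofReal_mul (by positivity), ENNReal.ofReal_mul two_pos.le, ENNReal.ofReal_ofNat]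
      congr 1
      refine Finset.sum_congr rfl fun k _ => ?_
      rw [two_inv, two_pow, ← ENNReal.ofReal_mul hp0n, ← ENNReal.ofReal_mul (by positivity),
        ENNReal.ofReal_rpow_of_nonneg (by positivity) (by norm_num),
        ENNReal.ofReal_mul (by positivity)]
    rw [e, ← ENNReal.ofReal_mul (by positivity)]
    refine ENNReal.ofReal_le_ofReal ?_
    have h1 := shell_contribution_le hd hN (hp0 n)
    have h2 : p n ^ (1 - 1 / (d : ℝ)) ≤ 2 ^ (q * (1 - n) * (1 - 1 / (d : ℝ))) := by
      rw [Real.rpow_mul two_pos.le]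
      exact Real.rpow_le_rpow (hp0 n) (shell_measureReal_le hM (by linarith) μ hμ n) (by linarith)
    -- Growth of the radius against decay of the mass: the product is geometric with ratio `ρ < 1`.
    have h3 : (2 : ℝ) ^ n * 2 ^ (q * (1 - n) * (1 - 1 / (d : ℝ))) =
        2 ^ (q * (1 - 1 / (d : ℝ))) * ρ ^ n := by
      rw [hρ, ← Real.rpow_natCast, ← Real.rpow_natCast, ← Real.rpow_mul two_pos.le,
        ← Real.rpow_add two_pos, ← Real.rpow_add two_pos]
      congr 1
      ring
    calc _ ≤ cubeDiam nrm * (M * 2 ^ n) * (S * (N : ℝ) ^ (-(1 / (d : ℝ))) *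
          2 ^ (q * (1 - n) * (1 - 1 / (d : ℝ)))) := by
          gcongr
          exact h1.trans (by gcongr)
      _ = cubeDiam nrm * M * S * (N : ℝ) ^ (-(1 / (d : ℝ))) *
          (2 ^ n * 2 ^ (q * (1 - n) * (1 - 1 / (d : ℝ)))) := by ring
      _ = _ := by rw [h3]; ring
  refine (ENNReal.tsum_le_tsum hterm).trans (le_of_eq ?_)
  rw [← ENNReal.ofReal_tsum_of_nonneg (fun n => by positivity)
    ((summable_geometric_of_lt_one hρ0.le hρ1).mul_left _), tsum_mul_left,
    tsum_geometric_of_lt_one hρ0.le hρ1, ← ENNReal.ofReal_natCast N,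
    ENNReal.ofReal_rpow_of_pos hN0]
  have h1ρ : 0 < 1 - ρ := by linarith
  rw [← ENNReal.ofReal_mul, ← ENNReal.ofReal_mul]
  · congr 1
    rw [shellConst]
    ring
  · rw [shellConst]; positivity
  · rw [shellConst]; positivity

lemma cubeDiam_pos (hd : 3 ≤ d) (hnrm : ∀ x, nrm x = 0 → x = 0) : 0 < cubeDiam nrm := by
  have h := seminorm_le_cubeDiam_mul nrm (Pi.single (⟨0, by omega⟩ : Fin d) 1)
  have h0 : nrm (Pi.single (⟨0, by omega⟩ : Fin d) 1) ≠ 0 := by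
    intro h0
    have := congrFun (hnrm _ h0) ⟨0, by omega⟩
    simp at this
  have h1 : 0 < nrm (Pi.single (⟨0, by omega⟩ : Fin d) 1) :=
    lt_of_le_of_ne (apply_nonneg _ _) h0.symm
  by_contra! h2
  nlinarith [norm_nonneg (Pi.single (⟨0, by omega⟩ : Fin d) 1 : Fin d → ℝ)]

lemma shellConst_pos (hd : 3 ≤ d) (hnrm : ∀ x, nrm x = 0 → x = 0) {q : ℝ}
    (hq : (d : ℝ) / ((d : ℝ) - 1) < q) : 0 < shellConst nrm q := by
  obtain ⟨hq', hq1⟩ := one_lt_exponent hd hq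
  have hD := cubeDiam_pos hd hnrm
  have hdR : (3 : ℝ) ≤ d := by exact_mod_cast hd
  have h1 : 0 < 1 - (2 : ℝ) ^ (1 - (d : ℝ) / 2) := sub_pos.2
    (Real.rpow_lt_one_of_one_lt_of_neg one_lt_two (by linarith))
  have h2 : 0 < 1 - (2 : ℝ) ^ (1 - q * (1 - 1 / (d : ℝ))) := sub_pos.2
    (Real.rpow_lt_one_of_one_lt_of_neg one_lt_two (by linarith))
  rw [shellConst]
  positivity

lemma natCast_rpow_ne {N : ℕ} (hN : 1 ≤ N) (s : ℝ) :
    (N : ℝ≥0∞) ^ s ≠ 0 ∧ (N : ℝ≥0∞) ^ s ≠ ∞ := by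
  have hN0 : (N : ℝ≥0∞) ≠ 0 := by exact_mod_cast (by omega : N ≠ 0)
  exact ⟨by simp [ENNReal.rpow_eq_zero_iff, hN0], by simp [ENNReal.rpow_eq_top_iff, hN0]⟩

/-- The scale `M` is taken to be the moment norm plus `ε`, since it must be positive even when the
moment vanishes. For an infinite moment, positivity of the constant is essential, because `0 * ∞ =
0`. -/
lemma isPierceConst_shellConst (hd : 3 ≤ d) (hnrm : ∀ x, nrm x = 0 → x = 0) {q : ℝ}
    (hq : (d : ℝ) / ((d : ℝ) - 1) < q) :
    IsPierceConst nrm 1 q (ENNReal.ofReal (shellConst nrm q)) := by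
  obtain ⟨hq', hq1⟩ := one_lt_exponent hd hq
  intro μ _ N hN
  obtain ⟨hN0, hNt⟩ := natCast_rpow_ne hN (-(1 / (d : ℝ)))
  have hc : ENNReal.ofReal (shellConst nrm q) ≠ 0 :=
    (ENNReal.ofReal_pos.2 (shellConst_pos hd hnrm hq)).ne'
  rcases eq_or_ne (maxMoment q μ) ∞ with ht | ht
  · rw [ht, ENNReal.top_rpow_of_pos (by positivity), ENNReal.mul_top hc, ENNReal.top_mul hN0]
    exact le_top
  set m : ℝ := (maxMoment q μ).toReal ^ (1 / q) with hm
  have hm0 : 0 ≤ m := by positivity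
  have hmom : maxMoment q μ ^ (1 / q) = ENNReal.ofReal m := by
    rw [hm, ← ENNReal.ofReal_rpow_of_nonneg ENNReal.toReal_nonneg (by positivity),
      ENNReal.ofReal_toReal ht]
  have hlim : Tendsto (fun ε : ℝ => ENNReal.ofReal (shellConst nrm q) * ENNReal.ofReal (m + ε) *
      (N : ℝ≥0∞) ^ (-(1 / (d : ℝ)))) (𝓝[>] 0) (𝓝 (ENNReal.ofReal (shellConst nrm q) *
        ENNReal.ofReal (m + 0) * (N : ℝ≥0∞) ^ (-(1 / (d : ℝ))))) := by
    refine ENNReal.Tendsto.mul_const (ENNReal.Tendsto.const_mul ?_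
      (Or.inr ENNReal.ofReal_ne_top)) (Or.inr hNt)
    refine Tendsto.mono_left ?_ nhdsWithin_le_nhds
    exact (ENNReal.continuous_ofReal.comp (continuous_const.add continuous_id)).tendsto 0
  rw [hmom]
  rw [add_zero] at hlim
  refine ge_of_tendsto hlim (eventually_mem_nhdsWithin.mono fun ε (hε : 0 < ε) => ?_)
  refine randError_le_of_maxMoment_le hd hq (by positivity) μ ?_ hN
  rw [← ENNReal.ofReal_toReal ht]
  refine ENNReal.ofReal_le_ofReal ?_
  calc (maxMoment q μ).toReal = m ^ q := by
        rw [hm, ← Real.rpow_mul ENNReal.toReal_nonneg, one_div, inv_mul_cancel₀ (by linarith),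
          Real.rpow_one]
    _ ≤ (m + ε) ^ q := Real.rpow_le_rpow hm0 (by linarith) (by linarith)

/-- The second summand of the explicit constant alone suffices: with `S` as below, `4 + S ≤ 2 * (S +
2)`, and the power of 2 in the cube constant is at least 1. -/
lemma shellConst_le_explicitPierceConst (hd : 3 ≤ d) {q : ℝ} (hq : 2 < q) :
    shellConst nrm q ≤ explicitPierceConst nrm 1 q := by
  have hD := cubeDiam_nonneg nrm
  have hdR : (3 : ℝ) ≤ d := by exact_mod_cast hd
  have hd1 : 1 / (d : ℝ) ≤ 1 / 3 := by gcongr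
  have hq' : 1 < q * (1 - 1 / (d : ℝ)) := by nlinarith
  have h1 : 0 < 1 - (2 : ℝ) ^ (1 - (d : ℝ) / 2) := sub_pos.2
    (Real.rpow_lt_one_of_one_lt_of_neg one_lt_two (by linarith))
  have h2 : 0 < 1 - (2 : ℝ) ^ (1 - q * (1 - 1 / (d : ℝ))) := sub_pos.2
    (Real.rpow_lt_one_of_one_lt_of_neg one_lt_two (by linarith))
  have h3 : 0 < 1 - (2 : ℝ) ^ (1 - q / 2) := sub_pos.2
    (Real.rpow_lt_one_of_one_lt_of_neg one_lt_two (by linarith))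
  have h4 : 1 ≤ (2 : ℝ) ^ (((d : ℝ) - 2) / 2) := Real.one_le_rpow one_le_two (by linarith)
  have e1 : (1 : ℝ) / (1 - 2 ^ (-1 : ℝ)) = 2 := by
    rw [Real.rpow_neg_one]; norm_num
  have e2 : -(q * (1 - 1 / (d : ℝ))) + 1 = 1 - q * (1 - 1 / (d : ℝ)) := by ring
  simp only [explicitPierceConst, explicitCubeConst, shellConst, mul_one, div_one, Real.rpow_one,
    e1, e2, sub_self, Real.rpow_zero, one_mul]
  rw [Real.rpow_add two_pos, Real.rpow_one]
  set Q : ℝ := 2 ^ (q * (1 - 1 / (d : ℝ))) with hQ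
  set S : ℝ := 1 / (1 - 2 ^ (1 - (d : ℝ) / 2)) with hS
  have hS0 : 0 < S := by positivity
  set T : ℝ := 1 - (2 : ℝ) ^ (1 - q * (1 - 1 / (d : ℝ))) with hT
  have hQ0 : 0 < Q := by positivity
  calc cubeDiam nrm * (4 + S) * (Q / T)
      ≤ cubeDiam nrm * (2 * 2 ^ (((d : ℝ) - 2) / 2) * (S + 2)) * (Q / T) := by
        gcongr
        nlinarith
    _ = 2 * Q * (cubeDiam nrm * 2 ^ (((d : ℝ) - 2) / 2) * (S + 2)) / T := by ring
    _ ≤ _ := le_add_of_nonneg_left (by positivity)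

/-- The triangle inequality for the distance to a fixed point, integrated over a coupling. It serves
as a lower bound on transport costs. -/
lemma lintegral_le_transportCost_add (a b : Measure (Fin d → ℝ)) (v : Fin d → ℝ) :
    ∫⁻ y, ENNReal.ofReal (nrm (y - v)) ∂a ≤
      transportCost nrm a b + ∫⁻ y, ENNReal.ofReal (nrm (y - v)) ∂b := by
  rw [transportCost]
  simp only [ENNReal.iInf_add]
  refine le_iInf₂ fun ξ hξ => ?_
  rw [← hξ.1, ← hξ.2, lintegral_map (by fun_prop) measurable_fst,
    lintegral_map (by fun_prop) measurable_snd, ← lintegral_add_left (by fun_prop)]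
  refine lintegral_mono fun z => ?_
  rw [← ENNReal.ofReal_add (apply_nonneg _ _) (apply_nonneg _ _)]
  refine ENNReal.ofReal_le_ofReal ?_
  have := map_add_le_add nrm (z.1 - z.2) (z.2 - v)
  simpa using this

/-- One sample point cannot approximate two equal atoms at distance `nrm e` with cost below half
that distance. Without this, measures of infinite moment would break the estimate for the optimal
constant, by `0 * ∞ = 0`. -/
lemma pierceConst_ne_zero (hd : 3 ≤ d) (hnrm : ∀ x, nrm x = 0 → x = 0) {q : ℝ} (hq : 0 < q) :
    pierceConst nrm 1 q ≠ 0 := by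
  set e : Fin d → ℝ := Pi.single (⟨0, by omega⟩ : Fin d) 1 with he
  have he0 : nrm e ≠ 0 := by
    intro h0
    have := congrFun (hnrm _ h0) ⟨0, by omega⟩
    simp [he] at this
  have hepos : 0 < nrm e := lt_of_le_of_ne (apply_nonneg _ _) he0.symm
  have hen : ‖e‖ₑ = 1 := by
    rw [← ofReal_norm, he, Pi.norm_single, norm_one, ENNReal.ofReal_one]
  set μ : Measure (Fin d → ℝ) :=
    (2 : ℝ≥0∞)⁻¹ • (Measure.dirac 0 + Measure.dirac e) with hμ
  have pμ : IsProbabilityMeasure μ := ⟨by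
    simp [hμ, ENNReal.inv_two_add_inv_two]⟩
  have hmom : maxMoment q μ ≤ 1 := by
    simp [maxMoment, hμ, lintegral_add_measure, hen, ENNReal.zero_rpow_of_pos hq]
  have key : ∀ x : Fin 1 → (Fin d → ℝ),
      (2 : ℝ≥0∞)⁻¹ * ENNReal.ofReal (nrm e) ≤ transportCost nrm μ (empirical x) := by
    intro x
    have h := lintegral_le_transportCost_add (nrm := nrm) μ (empirical x) (x 0)
    rw [lintegral_empirical] at h
    simp only [Nat.cast_one, inv_one, Finset.univ_unique, Fin.default_eq_zero, Fin.isValue,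
      Finset.sum_singleton, sub_self, map_zero, ENNReal.ofReal_zero, mul_zero, add_zero] at h
    refine le_trans ?_ h
    rw [hμ, lintegral_smul_measure, lintegral_add_measure, lintegral_dirac, lintegral_dirac,
      smul_eq_mul, ← ENNReal.ofReal_add (apply_nonneg _ _) (apply_nonneg _ _)]
    gcongr
    have h2 := map_sub_le_add nrm (e - x 0) (0 - x 0)
    rw [add_comm]
    simpa using h2
  have hlow : ∀ κ ∈ {κ | IsPierceConst nrm 1 q κ}, (2 : ℝ≥0∞)⁻¹ * ENNReal.ofReal (nrm e) ≤ κ := by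
    intro κ hκ
    have h1 := hκ μ pμ 1 le_rfl
    rw [randError_one] at h1
    have h2 := (lintegral_mono (μ := Measure.pi fun _ : Fin 1 => μ) key).trans h1
    rw [lintegral_const, measure_univ, mul_one] at h2
    refine h2.trans ?_
    rw [Nat.cast_one, ENNReal.one_rpow, mul_one]
    exact mul_le_of_le_one_right' (ENNReal.rpow_le_one hmom (by positivity))
  have hpos : 0 < (2 : ℝ≥0∞)⁻¹ * ENNReal.ofReal (nrm e) :=
    ENNReal.mul_pos (by simp) (ENNReal.ofReal_pos.2 hepos).ne'
  exact (hpos.trans_le (le_sInf hlow)).ne'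

lemma pierceConst_ne_top (hd : 3 ≤ d) (hnrm : ∀ x, nrm x = 0 → x = 0) {q : ℝ}
    (hq : (d : ℝ) / ((d : ℝ) - 1) < q) : pierceConst nrm 1 q ≠ ∞ :=
  ne_top_of_le_ne_top ENNReal.ofReal_ne_top (sInf_le (isPierceConst_shellConst hd hnrm hq))

/-- The infimum is attained because the estimate is linear in the constant; only the degenerate
values `0` and `∞` of the factor need care. -/
lemma isPierceConst_pierceConst (hd : 3 ≤ d) (hnrm : ∀ x, nrm x = 0 → x = 0) {q : ℝ}
    (hq : (d : ℝ) / ((d : ℝ) - 1) < q) : IsPierceConst nrm 1 q (pierceConst nrm 1 q) := by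
  obtain ⟨hq', hq1⟩ := one_lt_exponent hd hq
  intro μ pμ N hN
  obtain ⟨hN0, hNt⟩ := natCast_rpow_ne hN (-(1 / (d : ℝ)))
  rcases eq_or_ne (maxMoment q μ) ∞ with ht | ht
  · rw [ht, ENNReal.top_rpow_of_pos (by positivity),
      ENNReal.mul_top (pierceConst_ne_zero hd hnrm (by linarith)), ENNReal.top_mul hN0]
    exact le_top
  set c := maxMoment q μ ^ (1 / q) * (N : ℝ≥0∞) ^ (-(1 / (d : ℝ))) with hc
  have hct : c ≠ ∞ := ENNReal.mul_ne_top (ENNReal.rpow_ne_top_of_nonneg (by positivity) ht) hNt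
  have h1 : ∀ κ, IsPierceConst nrm 1 q κ → randError nrm 1 N μ ≤ κ * c := by
    intro κ hκ
    rw [hc, ← mul_assoc]
    exact hκ μ pμ N hN
  rw [mul_assoc, ← hc]
  rcases eq_or_ne c 0 with hc0 | hc0
  · simpa [hc0] using h1 _ (isPierceConst_shellConst hd hnrm hq)
  rw [← ENNReal.div_le_iff hc0 hct]
  refine le_sInf fun κ hκ => ?_
  rw [ENNReal.div_le_iff hc0 hct]
  exact h1 κ hκ

end PierceConstant

/-! ### Random subsamples and comparison of samples that partly agree. -/

section Subsample

variable {d : ℕ} {nrm : Seminorm ℝ (Fin d → ℝ)}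

/-- Jensen's inequality for a concave power. -/
lemma lintegral_rpow_le_rpow_lintegral {Ω : Type*} [MeasurableSpace Ω] (P : Measure Ω)
    [IsProbabilityMeasure P] {f : Ω → ℝ≥0∞} (hf : Measurable f) {r : ℝ} (hr0 : 0 < r)
    (hr1 : r ≤ 1) : ∫⁻ ω, f ω ^ r ∂P ≤ (∫⁻ ω, f ω ∂P) ^ r := by
  have h := eLpNorm'_le_eLpNorm'_of_exponent_le (f := f) hr0 hr1 P hf.aestronglyMeasurable
  simp only [eLpNorm', enorm_eq_self, ENNReal.rpow_one, div_one] at h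
  calc ∫⁻ ω, f ω ^ r ∂P = ((∫⁻ ω, f ω ^ r ∂P) ^ (1 / r)) ^ r := by
        rw [← ENNReal.rpow_mul, one_div, inv_mul_cancel₀ hr0.ne', ENNReal.rpow_one]
    _ ≤ _ := ENNReal.rpow_le_rpow h hr0.le

lemma pi_map_comp_injective {X : Type*} [MeasurableSpace X] (π : Measure X)
    [IsProbabilityMeasure π] {ι κ : Type*} [Fintype ι] [Fintype κ] {g : κ → ι}
    (hg : g.Injective) :
    (Measure.pi fun _ : ι => π).map (fun v => v ∘ g) = Measure.pi fun _ : κ => π := by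
  have h1 : iIndepFun (fun (i : ι) (v : ι → X) => v i) (Measure.pi fun _ : ι => π) :=
    iIndepFun_pi (μ := fun _ : ι => π) (X := fun _ => id) fun _ => aemeasurable_id
  have h2 := h1.precomp hg
  have h3 := (iIndepFun_iff_map_fun_eq_pi_map fun i => (measurable_pi_apply _).aemeasurable).1 h2
  have h4 : ∀ i : ι, (Measure.pi fun _ : ι => π).map (fun v => v i) = π := fun i =>
    (measurePreserving_eval (fun _ : ι => π) i).map_eq
  simp only [h4] at h3
  exact h3

variable {N : ℕ}

/-- The set of indices at which `I` is true. -/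
def selected (I : Fin N → Bool) : Finset (Fin N) := Finset.univ.filter fun i => I i = true

/-- The proportion of indices at which `I` is true. -/
def selectedFraction (I : Fin N → Bool) : ℝ≥0∞ := (N : ℝ≥0∞)⁻¹ * (selected I).card

/-- The part of the empirical measure that belongs to the selected indices. -/
def subEmpirical (I : Fin N → Bool) (x : Fin N → (Fin d → ℝ)) : Measure (Fin d → ℝ) :=
  (N : ℝ≥0∞)⁻¹ • ∑ i ∈ selected I, Measure.dirac (x i)

/-- The selected points. -/
def subSample (I : Fin N → Bool) (x : Fin N → (Fin d → ℝ)) :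
    Fin (selected I).card → (Fin d → ℝ) :=
  x ∘ (selected I).orderEmbOfFin rfl

lemma subEmpirical_eq (I : Fin N → Bool) (x : Fin N → (Fin d → ℝ)) :
    subEmpirical I x = selectedFraction I • empirical (subSample I x) := by
  rcases Nat.eq_zero_or_pos (selected I).card with h | h
  · have h1 : selectedFraction I = 0 := by simp [selectedFraction, h]
    rw [h1, zero_smul, subEmpirical, Finset.card_eq_zero.1 h]
    simp
  · have h0 : ((selected I).card : ℝ≥0∞) ≠ 0 := by exact_mod_cast h.ne'
    rw [subEmpirical, selectedFraction, empirical, smul_smul, mul_assoc,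
      ENNReal.mul_inv_cancel h0 (ENNReal.natCast_ne_top _), mul_one]
    congr 1
    conv_lhs => rw [← Finset.map_orderEmbOfFin_univ (selected I) rfl, Finset.sum_map]
    rfl

lemma selectedFraction_ne_top (I : Fin N → Bool) : selectedFraction I ≠ ∞ := by
  rcases Nat.eq_zero_or_pos N with rfl | h
  · simp [selectedFraction, selected]
  · have h0 : (N : ℝ≥0∞) ≠ 0 := by exact_mod_cast h.ne'
    exact ENNReal.mul_ne_top (ENNReal.inv_ne_top.2 h0) (ENNReal.natCast_ne_top _)

lemma selectedFraction_eq_sum (I : Fin N → Bool) :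
    selectedFraction I = (N : ℝ≥0∞)⁻¹ * ∑ i, ({true} : Set Bool).indicator (fun _ => 1) (I i) := by
  rw [selectedFraction]
  congr 1
  simp [selected, Set.indicator, Finset.sum_boole]

lemma toReal_selectedFraction (I : Fin N → Bool) : (selectedFraction I).toReal =
    (N : ℝ)⁻¹ * ∑ i, ({true} : Set Bool).indicator (fun _ => (1 : ℝ)) (I i) := by
  rw [selectedFraction]
  simp [selected, Set.indicator, Finset.sum_boole]

/-- Transport cost between the distribution `π` and the selected points, weighted by their mass. -/
def selectedCost (nrm : Seminorm ℝ (Fin d → ℝ)) (π : Measure (Fin d → ℝ))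
    (z : (Fin N → Bool) × (Fin N → (Fin d → ℝ))) : ℝ≥0∞ :=
  selectedFraction z.1 * transportCost nrm π (empirical (subSample z.1 z.2))

lemma transportCost_subEmpirical_le (π : Measure (Fin d → ℝ)) (I : Fin N → Bool)
    (x : Fin N → (Fin d → ℝ)) :
    transportCost nrm (selectedFraction I • π) (subEmpirical I x) ≤ selectedCost nrm π (I, x) := by
  rw [subEmpirical_eq]
  exact transportCost_smul_le _ _ _ (selectedFraction_ne_top I)

lemma measurable_subSample (I : Fin N → Bool) :
    Measurable (subSample I : (Fin N → (Fin d → ℝ)) → _) :=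
  measurable_pi_lambda _ fun _ => measurable_pi_apply _

lemma measurable_selectedCost (π : Measure (Fin d → ℝ)) :
    Measurable (selectedCost nrm π : (Fin N → Bool) × (Fin N → (Fin d → ℝ)) → ℝ≥0∞) := by
  refine measurable_from_prod_countable_right fun I => ?_
  rcases Nat.eq_zero_or_pos (selected I).card with h | h
  · have : ∀ x : Fin N → (Fin d → ℝ), selectedCost nrm π (I, x) = 0 := by
      intro x; simp [selectedCost, selectedFraction, h]
    simp only [this]
    exact measurable_const
  · exact ((measurable_transportCost_empirical (nrm := nrm) h π).comp
      (measurable_subSample I)).const_mul (selectedFraction I)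

/-- For a fixed selection with fraction `s`, the selected points are `s * N` independent draws from
`π`. The weight `s` times `(s * N) ^ (-1 / d)` gives `s ^ (1 - 1 / d) * N ^ (-1 / d)`. -/
lemma lintegral_selectedCost_le (π : Measure (Fin d → ℝ)) [IsProbabilityMeasure π] (hN : 1 ≤ N)
    {q : ℝ} {κ : ℝ≥0∞} (hd : 2 ≤ d) (hκ : IsPierceConst nrm 1 q κ) (β : Measure (Fin N → Bool)) :
    ∫⁻ z, selectedCost nrm π z ∂(β.prod (Measure.pi fun _ : Fin N => π)) ≤
      ∫⁻ I, κ * maxMoment q π ^ (1 / q) * (N : ℝ≥0∞) ^ (-(1 / (d : ℝ))) *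
        selectedFraction I ^ (1 - 1 / (d : ℝ)) ∂β := by
  rw [lintegral_prod _ (measurable_selectedCost π).aemeasurable]
  refine lintegral_mono fun I => ?_
  have hdR : (2 : ℝ) ≤ d := by exact_mod_cast hd
  have hd1 : 1 / (d : ℝ) ≤ 1 / 2 := by gcongr
  have hN0 : (N : ℝ≥0∞) ≠ 0 := by exact_mod_cast (by omega : N ≠ 0)
  rcases Nat.eq_zero_or_pos (selected I).card with h | h
  · simp [selectedCost, selectedFraction, h]
  have mS := measurable_subSample (d := d) I
  have e : ∫⁻ x, selectedCost nrm π (I, x) ∂(Measure.pi fun _ : Fin N => π) =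
      selectedFraction I * randError nrm 1 (selected I).card π := by
    have hmap : (Measure.pi fun _ : Fin N => π).map (subSample I) = Measure.pi fun _ => π :=
      pi_map_comp_injective π ((selected I).orderEmbOfFin rfl).injective
    simp only [selectedCost]
    rw [lintegral_const_mul' _ _ (selectedFraction_ne_top I), randError_one, ← hmap,
      lintegral_map (measurable_transportCost_empirical h π) mS]
  rw [e]
  refine (mul_le_mul_right (hκ π inferInstance _ h) _).trans (le_of_eq ?_)
  have hs0 : selectedFraction I ≠ 0 := by
    rw [selectedFraction]
    refine mul_ne_zero (ENNReal.inv_ne_zero.2 (ENNReal.natCast_ne_top _)) ?_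
    exact_mod_cast h.ne'
  have hcard : ((selected I).card : ℝ≥0∞) = N * selectedFraction I := by
    rw [selectedFraction, ← mul_assoc, ENNReal.mul_inv_cancel hN0 (ENNReal.natCast_ne_top _),
      one_mul]
  have hpow : selectedFraction I ^ (1 - 1 / (d : ℝ)) =
      selectedFraction I * selectedFraction I ^ (-(1 / (d : ℝ))) := by
    rw [sub_eq_add_neg, ENNReal.rpow_add _ _ hs0 (selectedFraction_ne_top I), ENNReal.rpow_one]
  rw [hcard, ENNReal.mul_rpow_of_ne_zero hN0 hs0, hpow]
  ring

/-- The smaller of the two weights, applied to `a + b`, stays in place. -/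
lemma transportCost_swap_weights_le (a b : Measure (Fin d → ℝ)) (s t : ℝ≥0∞) (hs : s ≠ ∞)
    (ht : t ≠ ∞) : transportCost nrm (t • a + s • b) (s • a + t • b) ≤
      ENNReal.ofReal |s.toReal - t.toReal| * transportCost nrm a b := by
  have key : ∀ (a b : Measure (Fin d → ℝ)) (s t : ℝ≥0∞), s ≠ ∞ → t ≠ ∞ → s ≤ t →
      transportCost nrm (t • a + s • b) (s • a + t • b) ≤
      ENNReal.ofReal |s.toReal - t.toReal| * transportCost nrm a b := by
    intro a b s t hs ht hst
    have e : ENNReal.ofReal |s.toReal - t.toReal| = t - s := by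
      rw [abs_sub_comm, abs_of_nonneg (sub_nonneg.2 (ENNReal.toReal_mono ht hst)),
        ← ENNReal.toReal_sub_of_le hst ht, ENNReal.ofReal_toReal (by finiteness)]
    have et : t = (t - s) + s := (tsub_add_cancel_of_le hst).symm
    have e1 : t • a + s • b = (t - s) • a + (s • a + s • b) := by
      conv_lhs => rw [et, add_smul, add_assoc]
    have e2 : s • a + t • b = (t - s) • b + (s • a + s • b) := by
      conv_lhs => rw [et, add_smul]
      abel
    rw [e, e1, e2]
    exact (transportCost_add_right_le _ _ _).trans (transportCost_smul_le _ _ _ (by finiteness))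
  rcases le_total s t with h | h
  · exact key a b s t hs ht h
  · have := key b a t s ht hs h
    rw [abs_sub_comm, transportCost_comm a b]
    rw [add_comm (t • a), add_comm (s • a)]
    exact this

lemma isFiniteMeasure_smul {X : Type*} [MeasurableSpace X] (a : Measure X) [IsFiniteMeasure a]
    {s : ℝ≥0∞} (hs : s ≠ ∞) : IsFiniteMeasure (s • a) :=
  ⟨by rw [Measure.smul_apply, smul_eq_mul]; exact ENNReal.mul_lt_top hs.lt_top (measure_lt_top a _)⟩

/-- Comparison of the approximation of two mixtures with a common component by samples that agree
outside of the selected indices. -/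
lemma transportCost_empirical_le_of_agree {μ ν m π₁ π₂ : Measure (Fin d → ℝ)} {t : ℝ≥0∞}
    (ht : t ≠ ∞) [IsProbabilityMeasure μ] [IsProbabilityMeasure ν] [IsProbabilityMeasure π₁]
    [IsProbabilityMeasure π₂] (hμ : μ = m + t • π₁) (hν : ν = m + t • π₂)
    (hfin : ∫⁻ x, ENNReal.ofReal (nrm x) ∂μ ≠ ∞) (hN : 1 ≤ N) (I : Fin N → Bool)
    (x y : Fin N → (Fin d → ℝ)) (hxy : ∀ i, I i = false → x i = y i) :
    transportCost nrm μ (empirical x) ≤ transportCost nrm ν (empirical y) +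
      (selectedCost nrm π₂ (I, y) + selectedCost nrm π₁ (I, x) +
        ENNReal.ofReal |(selectedFraction I).toReal - t.toReal| * transportCost nrm π₁ π₂) := by
  set s := selectedFraction I with hs
  have hst : s ≠ ∞ := selectedFraction_ne_top I
  have split : ∀ x : Fin N → (Fin d → ℝ), empirical x =
      (N : ℝ≥0∞)⁻¹ • ∑ i ∈ (selected I)ᶜ, Measure.dirac (x i) + subEmpirical I x := by
    intro x
    rw [empirical, subEmpirical, ← smul_add, add_comm, Finset.sum_add_sum_compl]
  have hcompl : ∑ i ∈ (selected I)ᶜ, Measure.dirac (x i) =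
      ∑ i ∈ (selected I)ᶜ, Measure.dirac (y i) := by
    refine Finset.sum_congr rfl fun i hi => ?_
    rw [hxy i (by simpa [selected] using hi)]
  have swap : empirical x + subEmpirical I y = empirical y + subEmpirical I x := by
    rw [split x, split y, hcompl]; abel
  have pz : ∀ z : Fin N → (Fin d → ℝ), IsFiniteMeasure (subEmpirical I z) := by
    intro z
    have := isProbabilityMeasure_empirical hN z
    exact isFiniteMeasure_of_le (empirical z) (by rw [split z]; exact Measure.le_add_left le_rfl)
  have px := isProbabilityMeasure_empirical hN x
  have py := isProbabilityMeasure_empirical hN y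
  have pzx := pz x
  have pzy := pz y
  have f1 : IsFiniteMeasure (t • π₁) := isFiniteMeasure_smul _ ht
  have f2 : IsFiniteMeasure (t • π₂) := isFiniteMeasure_smul _ ht
  have f3 : IsFiniteMeasure (s • π₁) := isFiniteMeasure_smul _ hst
  have f4 : IsFiniteMeasure (s • π₂) := isFiniteMeasure_smul _ hst
  have e1 : μ + (t • π₂ + subEmpirical I y) = ν + (t • π₁ + subEmpirical I y) := by
    rw [hμ, hν]; abel
  have e2 : empirical x + (t • π₂ + subEmpirical I y) =
      empirical y + (subEmpirical I x + t • π₂) := by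
    rw [add_left_comm, swap]; abel
  -- Cancellation is used in reverse: adding `t • π₂` and the selected points of `y` to both sides
  -- turns `μ` into `ν` and the sample `x` into `y`, leaving only a remainder of selected pieces.
  -- The remainder is split through mixtures with weights `s` and `t` interchanged.
  calc transportCost nrm μ (empirical x)
      ≤ transportCost nrm (μ + (t • π₂ + subEmpirical I y))
          (empirical x + (t • π₂ + subEmpirical I y)) := by
        refine transportCost_le_transportCost_add _ _ _ (by rw [measure_univ, measure_univ]) hfin ?_
        exact lintegral_norm_empirical_ne_top hN x fun _ => ENNReal.ofReal_ne_top
    _ ≤ transportCost nrm ν (empirical y) +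
          transportCost nrm (t • π₁ + subEmpirical I y) (subEmpirical I x + t • π₂) := by
        rw [e1, e2]
        exact transportCost_add_le _ _ _ _
    _ ≤ transportCost nrm ν (empirical y) +
          (transportCost nrm (t • π₁ + subEmpirical I y) (t • π₁ + s • π₂) +
          (transportCost nrm (t • π₁ + s • π₂) (s • π₁ + t • π₂) +
            transportCost nrm (s • π₁ + t • π₂) (subEmpirical I x + t • π₂))) := by
        gcongr
        exact (transportCost_triangle _ (t • π₁ + s • π₂) _).trans
          (by gcongr; exact transportCost_triangle _ (s • π₁ + t • π₂) _)
    _ ≤ transportCost nrm ν (empirical y) + (selectedCost nrm π₂ (I, y) +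
          (ENNReal.ofReal |s.toReal - t.toReal| * transportCost nrm π₁ π₂ +
            selectedCost nrm π₁ (I, x))) := by
        gcongr
        · rw [transportCost_comm, add_comm (t • π₁), add_comm (t • π₁)]
          exact (transportCost_add_right_le _ _ _).trans (transportCost_subEmpirical_le _ _ _)
        · exact transportCost_swap_weights_le _ _ _ _ hst ht
        · exact (transportCost_add_right_le _ _ _).trans (transportCost_subEmpirical_le _ _ _)
    _ = _ := by ring

end Subsample

/-! ### Coupled samples of two mixtures with a common component. -/

section Mixture

variable {d : ℕ} {nrm : Seminorm ℝ (Fin d → ℝ)}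

/-- The Bernoulli distribution with success probability `t`. -/
def bernoulli (t : ℝ≥0∞) : Measure Bool := t • Measure.dirac true + (1 - t) • Measure.dirac false

lemma isProbabilityMeasure_bernoulli {t : ℝ≥0∞} (ht : t ≤ 1) :
    IsProbabilityMeasure (bernoulli t) :=
  ⟨by simp [bernoulli, add_tsub_cancel_of_le ht]⟩

lemma bernoulli_true (t : ℝ≥0∞) : bernoulli t {true} = t := by
  simp [bernoulli]

variable {N : ℕ}

/-- A sample of a mixture: the `i`-th point is `w i` if `I i` is true, and `u i` otherwise. -/
def mixSample (I : Fin N → Bool) (u w : Fin N → (Fin d → ℝ)) : Fin N → (Fin d → ℝ) :=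
  fun i => if I i = true then w i else u i

lemma selectedCost_mixSample (π : Measure (Fin d → ℝ)) (I : Fin N → Bool)
    (u w : Fin N → (Fin d → ℝ)) :
    selectedCost nrm π (I, mixSample I u w) = selectedCost nrm π (I, w) := by
  have : subSample I (mixSample I u w) = subSample I w := by
    funext j
    have hj : (selected I).orderEmbOfFin rfl j ∈ selected I := Finset.orderEmbOfFin_mem _ _ _
    have h : I ((selected I).orderEmbOfFin rfl j) = true := by
      simpa only [selected, Finset.mem_filter, Finset.mem_univ, true_and] using hj
    simp only [subSample, Function.comp_apply, mixSample, if_pos h]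
  simp only [selectedCost, this]

lemma measurable_mixSample {Ω : Type*} [MeasurableSpace Ω] {I : Ω → Fin N → Bool}
    {u w : Ω → Fin N → (Fin d → ℝ)} (hI : Measurable I) (hu : Measurable u) (hw : Measurable w) :
    Measurable fun ω => mixSample (I ω) (u ω) (w ω) := by
  refine measurable_pi_lambda _ fun i => ?_
  refine Measurable.ite ?_ ((measurable_pi_apply i).comp hw) ((measurable_pi_apply i).comp hu)
  exact ((measurable_pi_apply i).comp hI) (measurableSet_singleton true)

/-- The mixed sample is an independent sample from the mixture. -/
lemma map_mixSample {F : Type*} [MeasurableSpace F] (θ : Measure F) [IsProbabilityMeasure θ]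
    {u w : F → (Fin d → ℝ)} (hu : Measurable u) (hw : Measurable w) {t : ℝ≥0∞} (ht : t ≤ 1)
    {μ : Measure (Fin d → ℝ)} [IsProbabilityMeasure μ]
    (hμ : μ = (1 - t) • θ.map u + t • θ.map w) :
    ((Measure.pi fun _ : Fin N => bernoulli t).prod (Measure.pi fun _ : Fin N => θ)).map
      (fun z => mixSample z.1 (fun i => u (z.2 i)) (fun i => w (z.2 i))) =
      Measure.pi fun _ : Fin N => μ := by
  have := isProbabilityMeasure_bernoulli ht
  set f : Bool × F → (Fin d → ℝ) := fun z => if z.1 = true then w z.2 else u z.2 with hf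
  have mf : Measurable f :=
    Measurable.ite (measurable_fst (measurableSet_singleton true)) (hw.comp measurable_snd)
      (hu.comp measurable_snd)
  have hlaw : ((bernoulli t).prod θ).map f = μ := by
    rw [bernoulli, Measure.add_prod, Measure.prod_smul_left, Measure.prod_smul_left,
      Measure.dirac_prod, Measure.dirac_prod, Measure.map_add _ _ mf, Measure.map_smul,
      Measure.map_smul, Measure.map_map mf (by fun_prop), Measure.map_map mf (by fun_prop), hμ,
      add_comm]
    rfl
  have mp := measurePreserving_arrowProdEquivProdArrow Bool F (Fin N)
    (fun _ => bernoulli t) (fun _ => θ)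
  have mmix : Measurable fun z : (Fin N → Bool) × (Fin N → F) =>
      mixSample z.1 (fun i => u (z.2 i)) (fun i => w (z.2 i)) :=
    measurable_mixSample measurable_fst (by fun_prop) (by fun_prop)
  rw [← mp.map_eq, Measure.map_map mmix mp.measurable]
  have hpi := Measure.pi_map_pi (μ := fun _ : Fin N => (bernoulli t).prod θ) (f := fun _ => f)
    (hμ := fun _ => by rw [hlaw]; infer_instance) (fun _ => mf.aemeasurable)
  simp only [hlaw] at hpi
  exact hpi

/-- The random quantization errors of two mixtures with a common component differ at most by the
quantization errors of the different components, up to a term of order `N ^ (-1 / 2)`. -/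
lemma randError_mixture_le {μ ν m π₁ π₂ : Measure (Fin d → ℝ)} {t : ℝ≥0∞} (ht : t ≤ 1)
    [IsProbabilityMeasure μ] [IsProbabilityMeasure ν] [IsProbabilityMeasure m]
    [IsProbabilityMeasure π₁] [IsProbabilityMeasure π₂]
    (hμ : μ = (1 - t) • m + t • π₁) (hν : ν = (1 - t) • m + t • π₂)
    (hfin : ∫⁻ x, ENNReal.ofReal (nrm x) ∂μ ≠ ∞) (hN : 1 ≤ N) (hd : 2 ≤ d) {q : ℝ} {κ : ℝ≥0∞}
    (hκ : IsPierceConst nrm 1 q κ) :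
    randError nrm 1 N μ ≤ randError nrm 1 N ν +
      (κ * (maxMoment q π₁ ^ (1 / q) + maxMoment q π₂ ^ (1 / q)) * (N : ℝ≥0∞) ^ (-(1 / (d : ℝ))) *
        t ^ (1 - 1 / (d : ℝ)) + (N : ℝ≥0∞)⁻¹ ^ (1 / 2 : ℝ) * transportCost nrm π₁ π₂) := by
  have htt : t ≠ ∞ := ne_top_of_le_ne_top ENNReal.one_ne_top ht
  have pb := isProbabilityMeasure_bernoulli ht
  have hdR : (2 : ℝ) ≤ d := by exact_mod_cast hd
  have hd1 : 1 / (d : ℝ) ≤ 1 / 2 := by gcongr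
  -- Each index carries a point of `m`, of `π₁` and of `π₂`; one shared coin decides whether the
  -- common point or the individual ones are used.
  set θ := m.prod (π₁.prod π₂) with hθ
  have mθ0 : θ.map (fun z => z.1) = m := by
    have := Measure.map_fst_prod (μ := m) (ν := π₁.prod π₂)
    rwa [measure_univ, one_smul] at this
  have mθ' : θ.map (fun z => z.2) = π₁.prod π₂ := by
    have := Measure.map_snd_prod (μ := m) (ν := π₁.prod π₂)
    rwa [measure_univ, one_smul] at this
  have mθ1 : θ.map (fun z => z.2.1) = π₁ := by
    have h1 := Measure.map_fst_prod (μ := π₁) (ν := π₂)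
    rw [measure_univ, one_smul, ← mθ', Measure.map_map measurable_fst measurable_snd] at h1
    exact h1
  have mθ2 : θ.map (fun z => z.2.2) = π₂ := by
    have h1 := Measure.map_snd_prod (μ := π₁) (ν := π₂)
    rw [measure_univ, one_smul, ← mθ', Measure.map_map measurable_snd measurable_snd] at h1
    exact h1
  set B := Measure.pi fun _ : Fin N => bernoulli t with hB
  set Θ := Measure.pi fun _ : Fin N => θ with hΘ
  set P := B.prod Θ with hP
  set X : (Fin N → Bool) × (Fin N → (Fin d → ℝ) × (Fin d → ℝ) × (Fin d → ℝ)) →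
    Fin N → (Fin d → ℝ) := fun z => mixSample z.1 (fun i => (z.2 i).1) (fun i => (z.2 i).2.1) with hX
  set Y : (Fin N → Bool) × (Fin N → (Fin d → ℝ) × (Fin d → ℝ) × (Fin d → ℝ)) →
    Fin N → (Fin d → ℝ) := fun z => mixSample z.1 (fun i => (z.2 i).1) (fun i => (z.2 i).2.2) with hY
  have mX : Measurable X := measurable_mixSample measurable_fst (by fun_prop) (by fun_prop)
  have mY : Measurable Y := measurable_mixSample measurable_fst (by fun_prop) (by fun_prop)
  have lX : P.map X = Measure.pi fun _ : Fin N => μ :=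
    map_mixSample θ (u := fun z => z.1) (w := fun z => z.2.1) (by fun_prop) (by fun_prop) ht
      (by rw [mθ0, mθ1]; exact hμ)
  have lY : P.map Y = Measure.pi fun _ : Fin N => ν :=
    map_mixSample θ (u := fun z => z.1) (w := fun z => z.2.2) (by fun_prop) (by fun_prop) ht
      (by rw [mθ0, mθ2]; exact hν)
  have msel : Measurable fun z : (Fin N → Bool) × (Fin N → (Fin d → ℝ) × (Fin d → ℝ) × (Fin d → ℝ))
      => selectedFraction z.1 := (measurable_of_countable selectedFraction).comp measurable_fst
  have mproj2 : Measurable fun z : (Fin N → Bool) ×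
      (Fin N → (Fin d → ℝ) × (Fin d → ℝ) × (Fin d → ℝ)) => (z.1, fun i => (z.2 i).2.2) := by
    fun_prop
  have pointwise : ∀ z, transportCost nrm μ (empirical (X z)) ≤
      transportCost nrm ν (empirical (Y z)) +
      (selectedCost nrm π₂ (z.1, fun i => (z.2 i).2.2) +
        selectedCost nrm π₁ (z.1, fun i => (z.2 i).2.1) +
        ENNReal.ofReal |(selectedFraction z.1).toReal - t.toReal| * transportCost nrm π₁ π₂) := by
    intro z
    have := transportCost_empirical_le_of_agree htt hμ hν hfin hN z.1 (X z) (Y z) (by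
      intro i hi
      simp [hX, hY, mixSample, hi])
    rwa [hX, hY, selectedCost_mixSample, selectedCost_mixSample] at this
  have hmean : ∫⁻ I, selectedFraction I ∂B = t := by
    simp only [selectedFraction_eq_sum]
    rw [lintegral_pi_average (bernoulli t) hN (measurable_of_countable _),
      lintegral_indicator_const (measurableSet_singleton _), bernoulli_true, one_mul]
  have hcost : ∀ (π : Measure (Fin d → ℝ)) [IsProbabilityMeasure π]
      (g : (Fin d → ℝ) × (Fin d → ℝ) × (Fin d → ℝ) → (Fin d → ℝ)), Measurable g → θ.map g = π →
      ∫⁻ z, selectedCost nrm π (z.1, fun i => g (z.2 i)) ∂P ≤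
        κ * maxMoment q π ^ (1 / q) * (N : ℝ≥0∞) ^ (-(1 / (d : ℝ))) * t ^ (1 - 1 / (d : ℝ)) := by
    intro π _ g hg hgπ
    have hpi := Measure.pi_map_pi (μ := fun _ : Fin N => θ) (f := fun _ => g)
      (hμ := fun _ => by rw [hgπ]; infer_instance) (fun _ => hg.aemeasurable)
    simp only [hgπ] at hpi
    have hPmap : P.map (fun z => (z.1, fun i => g (z.2 i))) =
        B.prod (Measure.pi fun _ : Fin N => π) := by
      rw [← hpi]
      conv_rhs => rw [← Measure.map_id (μ := B)]
      rw [Measure.map_prod_map _ _ measurable_id (by fun_prop)]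
      rfl
    have h1 := lintegral_selectedCost_le (nrm := nrm) π hN hd hκ B
    rw [← hPmap, lintegral_map (measurable_selectedCost π) (by fun_prop)] at h1
    refine h1.trans ?_
    rw [lintegral_const_mul _ (measurable_of_countable _)]
    gcongr
    -- Jensen's inequality for the selected fraction, whose mean is `t`.
    refine (lintegral_rpow_le_rpow_lintegral B (measurable_of_countable _) (by linarith)
      (by linarith [show 0 ≤ 1 / (d : ℝ) by positivity])).trans ?_
    rw [hmean]
  have hdev : ∫⁻ z, ENNReal.ofReal |(selectedFraction z.1).toReal - t.toReal| ∂P ≤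
      (N : ℝ≥0∞)⁻¹ ^ (1 / 2 : ℝ) := by
    have h1 := lintegral_abs_frequency_sub_le (bernoulli t) hN (measurableSet_singleton true)
    simp only [← toReal_selectedFraction, measureReal_def, bernoulli_true] at h1
    have h2 : ∫⁻ z, ENNReal.ofReal |(selectedFraction z.1).toReal - t.toReal| ∂P =
        ∫⁻ I, ENNReal.ofReal |(selectedFraction I).toReal - t.toReal| ∂B := by
      have := Measure.map_fst_prod (μ := B) (ν := Θ)
      rw [measure_univ, one_smul] at this
      rw [← this, lintegral_map (measurable_of_countable _) measurable_fst]
    rw [h2]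
    refine h1.trans (ENNReal.rpow_le_rpow ?_ (by norm_num))
    rw [div_eq_mul_inv]
    exact mul_le_of_le_one_left' ht
  have mdev : Measurable fun z : (Fin N → Bool) ×
      (Fin N → (Fin d → ℝ) × (Fin d → ℝ) × (Fin d → ℝ)) =>
      ENNReal.ofReal |(selectedFraction z.1).toReal - t.toReal| * transportCost nrm π₁ π₂ := by
    fun_prop
  have mcost : Measurable fun z => transportCost nrm ν (empirical (Y z)) :=
    (measurable_transportCost_empirical hN ν).comp mY
  have msel2 : Measurable fun z : (Fin N → Bool) ×
      (Fin N → (Fin d → ℝ) × (Fin d → ℝ) × (Fin d → ℝ)) =>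
      selectedCost nrm π₂ (z.1, fun i => (z.2 i).2.2) :=
    (measurable_selectedCost π₂).comp mproj2
  rw [randError_one, randError_one, ← lX, ← lY,
    lintegral_map (measurable_transportCost_empirical hN μ) mX,
    lintegral_map (measurable_transportCost_empirical hN ν) mY]
  refine (lintegral_mono pointwise).trans ?_
  rw [lintegral_add_left mcost,
    lintegral_add_right _ mdev,
    lintegral_add_left msel2,
    lintegral_mul_const _ (by fun_prop)]
  gcongr
  refine (add_le_add (hcost π₂ (fun z => z.2.2) (by fun_prop) mθ2)
    (hcost π₁ (fun z => z.2.1) (by fun_prop) mθ1)).trans (le_of_eq ?_)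
  ring

end Mixture

/-! ### Asymptotic comparison in total variation. -/

section TotalVariation

variable {d : ℕ} {nrm : Seminorm ℝ (Fin d → ℝ)}

lemma tvBound_comm (q : ℝ) (μ ν : Measure (Fin d → ℝ)) [IsFiniteMeasure μ] [IsFiniteMeasure ν] :
    tvBound nrm q μ ν = tvBound nrm q ν μ := by
  simp only [tvBound, absSub_eq, add_comm]

/-- An empirical measure has finite first moment, so its distance to a measure without one is
infinite. -/
lemma randError_eq_top {μ : Measure (Fin d → ℝ)} [IsProbabilityMeasure μ]
    (hμ : ∫⁻ x, ENNReal.ofReal (nrm x) ∂μ = ∞) {N : ℕ} (hN : 1 ≤ N) : randError nrm 1 N μ = ∞ := by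
  have h : ∀ x : Fin N → (Fin d → ℝ), transportCost nrm μ (empirical x) = ∞ := by
    intro x
    have h1 := lintegral_le_transportCost_add (nrm := nrm) μ (empirical x) 0
    simp only [sub_zero, hμ, top_le_iff, ENNReal.add_eq_top] at h1
    exact h1.resolve_right (lintegral_norm_empirical_ne_top hN x fun _ => ENNReal.ofReal_ne_top)
  rw [randError_one]
  simp [h]

lemma lintegral_seminorm_ne_top {q : ℝ} (hq : 1 < q) (μ : Measure (Fin d → ℝ)) [IsFiniteMeasure μ]
    (hμ : maxMoment q μ ≠ ∞) : ∫⁻ x, ENNReal.ofReal (nrm x) ∂μ ≠ ∞ := by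
  have h : ∀ x, ENNReal.ofReal (nrm x) ≤ ENNReal.ofReal (cubeDiam nrm) * ENNReal.ofReal ‖x‖ := by
    intro x
    rw [← ENNReal.ofReal_mul (cubeDiam_nonneg nrm)]
    exact ENNReal.ofReal_le_ofReal (seminorm_le_cubeDiam_mul nrm x)
  refine ne_top_of_le_ne_top ?_ (lintegral_mono h)
  rw [lintegral_const_mul _ (by fun_prop)]
  exact ENNReal.mul_ne_top ENNReal.ofReal_ne_top (lintegral_norm_ne_top hq μ hμ)

/-- The exponent `1 / d - 1 / 2` is negative for `d ≥ 3`. -/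
lemma tendsto_scaled_fluctuation (hd : 3 ≤ d) {T : ℝ≥0∞} (hT : T ≠ ∞) :
    Tendsto (fun N : ℕ => (N : ℝ≥0∞) ^ (1 / (d : ℝ)) * ((N : ℝ≥0∞)⁻¹ ^ (1 / 2 : ℝ) * T)) atTop
      (𝓝 0) := by
  have hdR : (3 : ℝ) ≤ d := by exact_mod_cast hd
  have hd1 : 1 / (d : ℝ) ≤ 1 / 3 := by gcongr
  have h1 : Tendsto (fun N : ℕ => ENNReal.ofReal ((N : ℝ) ^ (-(1 / 2 - 1 / (d : ℝ)))) * T) atTop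
      (𝓝 (ENNReal.ofReal 0 * T)) := by
    refine ENNReal.Tendsto.mul_const (ENNReal.tendsto_ofReal ?_) (Or.inr hT)
    exact (tendsto_rpow_neg_atTop (by linarith)).comp tendsto_natCast_atTop_atTop
  rw [ENNReal.ofReal_zero, zero_mul] at h1
  refine h1.congr' ?_
  filter_upwards [eventually_ge_atTop 1] with N hN
  have hN0 : (0 : ℝ) < N := by exact_mod_cast hN
  have hNE : (N : ℝ≥0∞) ≠ 0 := by exact_mod_cast (by omega : N ≠ 0)
  rw [← ENNReal.ofReal_rpow_of_pos hN0, ENNReal.ofReal_natCast, ← mul_assoc]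
  congr 1
  rw [ENNReal.inv_rpow, ← ENNReal.rpow_neg, ← ENNReal.rpow_add _ _ hNE (ENNReal.natCast_ne_top N)]
  congr 1
  ring

/-- The mixture comparison is applied with `t` the mass of `μ - ν` and `π₁`, `π₂` the normalised
differences. Normalising contributes `t ^ (-1 / q)`, which combines with `t ^ (1 - 1 / d)` to the
exponent of the total variation. Degenerate and infinite cases are separated first. -/
lemma scaledError_le_add (hd : 3 ≤ d) (hnrm : ∀ x, nrm x = 0 → x = 0) {q : ℝ}
    (hq : (d : ℝ) / ((d : ℝ) - 1) < q) (μ ν : Measure (Fin d → ℝ)) [IsProbabilityMeasure μ]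
    [IsProbabilityMeasure ν] :
    ∃ c : ℕ → ℝ≥0∞, Tendsto c atTop (𝓝 0) ∧ ∀ᶠ N in atTop,
      scaledError nrm μ N ≤ scaledError nrm ν N + (tvBound nrm q μ ν + c N) := by
  obtain ⟨hq', hq1⟩ := one_lt_exponent hd hq
  have hdR : (3 : ℝ) ≤ d := by exact_mod_cast hd
  have hd1 : 1 / (d : ℝ) ≤ 1 / 3 := by gcongr
  have hqpos : 0 < q := by linarith
  have hexp : 0 < 1 - 1 / (d : ℝ) - 1 / q := by
    have h1 : 1 / q < 1 - 1 / (d : ℝ) := by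
      rw [div_lt_iff₀ hqpos]; linarith
    linarith
  by_cases htop : tvBound nrm q μ ν = ∞
  · exact ⟨fun _ => 0, tendsto_const_nhds, Eventually.of_forall fun N => by simp [htop]⟩
  obtain ⟨m, fm, h₁, h₂⟩ := exists_common_part μ ν
  have hu := sub_univ_eq_sub_univ μ ν
  have hTV : absSub μ ν = (μ - ν) + (ν - μ) := absSub_eq μ ν
  set p := μ - ν with hp
  set n := ν - μ with hn
  have fp : IsFiniteMeasure p := isFiniteMeasure_of_le μ Measure.sub_le
  have fn : IsFiniteMeasure n := isFiniteMeasure_of_le ν Measure.sub_le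
  set t := p Set.univ with ht
  have ht1 : t ≤ 1 := by
    rw [← measure_univ (μ := μ)]
    exact (Measure.sub_le : p ≤ μ) _
  have htt : t ≠ ∞ := measure_ne_top p _
  rcases eq_or_ne t 0 with ht0 | ht0
  · have hp0 : p = 0 := Measure.measure_univ_eq_zero.1 ht0
    have hn0 : n = 0 := Measure.measure_univ_eq_zero.1 (hu ▸ ht0)
    have : μ = ν := by rw [h₁, h₂, hp0, hn0]
    exact ⟨fun _ => 0, tendsto_const_nhds, Eventually.of_forall fun N => by
      simp [this]⟩
  have hpA : p ≤ absSub μ ν := by rw [hTV]; exact Measure.le_add_right le_rfl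
  have hnA : n ≤ absSub μ ν := by rw [hTV]; exact Measure.le_add_left le_rfl
  have hκ0 := pierceConst_ne_zero hd hnrm hqpos
  have hκt := pierceConst_ne_top hd hnrm hq
  -- A finite bound forces a finite moment, since the other factors are nonzero.
  have hmomA : maxMoment q (absSub μ ν) ≠ ∞ := by
    intro h
    refine htop ?_
    have hAu : absSub μ ν Set.univ ^ (1 - 1 / (d : ℝ) - 1 / q) ≠ 0 := by
      rw [Ne, ENNReal.rpow_eq_zero_iff]
      rintro (⟨h0, -⟩ | ⟨-, h0⟩)
      · exact ht0 (le_antisymm ((hpA _).trans_eq h0) bot_le)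
      · linarith
    rw [tvBound, h, ENNReal.top_rpow_of_pos (by positivity), ENNReal.mul_top]
    exact mul_ne_zero (mul_ne_zero two_ne_zero hκ0) hAu
  have hmomp : maxMoment q p ≤ maxMoment q (absSub μ ν) := lintegral_mono' hpA le_rfl
  have hmomn : maxMoment q n ≤ maxMoment q (absSub μ ν) := lintegral_mono' hnA le_rfl
  have hfp := lintegral_seminorm_ne_top (nrm := nrm) hq1 p (ne_top_of_le_ne_top hmomA hmomp)
  have hfn := lintegral_seminorm_ne_top (nrm := nrm) hq1 n (ne_top_of_le_ne_top hmomA hmomn)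
  -- The differences have finite first moment, so an infinite one must come from the common part;
  -- then both errors are infinite.
  by_cases hfin : ∫⁻ x, ENNReal.ofReal (nrm x) ∂μ = ∞
  · have hfin' : ∫⁻ x, ENNReal.ofReal (nrm x) ∂ν = ∞ := by
      rw [h₁, lintegral_add_measure, ENNReal.add_eq_top] at hfin
      rw [h₂, lintegral_add_measure, hfin.resolve_right hfp, top_add]
    refine ⟨fun _ => 0, tendsto_const_nhds, ?_⟩
    filter_upwards [eventually_ge_atTop 1] with N hN
    rw [scaledError, scaledError, randError_eq_top hfin' hN,
      ENNReal.mul_top (natCast_rpow_ne hN _).1, top_add]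
    exact le_top
  have hti : t⁻¹ ≠ ∞ := ENNReal.inv_ne_top.2 ht0
  have scale : ∀ a : Measure (Fin d → ℝ), a = t • (t⁻¹ • a) := fun a => by
    rw [smul_smul, ENNReal.mul_inv_cancel ht0 htt, one_smul]
  have pπ₁ : IsProbabilityMeasure (t⁻¹ • p) := ⟨by
    rw [Measure.smul_apply, smul_eq_mul, ENNReal.inv_mul_cancel ht0 htt]⟩
  have pπ₂ : IsProbabilityMeasure (t⁻¹ • n) := ⟨by
    rw [Measure.smul_apply, smul_eq_mul, ← hu, ENNReal.inv_mul_cancel ht0 htt]⟩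
  have hmu : m Set.univ = 1 - t := by
    have h := congrArg (fun a : Measure (Fin d → ℝ) => a Set.univ) h₁
    simp only [measure_univ, Measure.add_apply] at h
    exact ENNReal.eq_sub_of_add_eq htt h.symm
  obtain ⟨m', pm', hm'⟩ : ∃ m' : Measure (Fin d → ℝ), IsProbabilityMeasure m' ∧
      m = (1 - t) • m' := by
    rcases eq_or_ne (1 - t) 0 with h0 | h0
    · refine ⟨μ, inferInstance, ?_⟩
      rw [h0] at hmu ⊢
      rw [zero_smul, Measure.measure_univ_eq_zero.1 hmu]
    · have hft : 1 - t ≠ ∞ := by finiteness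
      refine ⟨(1 - t)⁻¹ • m, ⟨?_⟩, ?_⟩
      · rw [Measure.smul_apply, smul_eq_mul, hmu, ENNReal.inv_mul_cancel h0 hft]
      · rw [smul_smul, ENNReal.mul_inv_cancel h0 hft, one_smul]
  have hμ : μ = (1 - t) • m' + t • (t⁻¹ • p) := by rw [← hm', ← scale p]; exact h₁
  have hν : ν = (1 - t) • m' + t • (t⁻¹ • n) := by rw [← hm', ← scale n]; exact h₂
  set T := transportCost nrm (t⁻¹ • p) (t⁻¹ • n) with hT
  have hTt : T ≠ ∞ := by
    refine ne_top_of_le_ne_top ?_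
      (transportCost_le_of_univ_eq (by rw [measure_univ, measure_univ]))
    rw [lintegral_smul_measure, lintegral_smul_measure]
    exact ENNReal.add_ne_top.2 ⟨ENNReal.mul_ne_top hti hfp, ENNReal.mul_ne_top hti hfn⟩
  refine ⟨fun N => (N : ℝ≥0∞) ^ (1 / (d : ℝ)) * ((N : ℝ≥0∞)⁻¹ ^ (1 / 2 : ℝ) * T),
    tendsto_scaled_fluctuation hd hTt, ?_⟩
  filter_upwards [eventually_ge_atTop 1] with N hN
  have hN0 : (N : ℝ≥0∞) ≠ 0 := by exact_mod_cast (by omega : N ≠ 0)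
  have main := randError_mixture_le (nrm := nrm) ht1 hμ hν hfin hN (by omega)
    (isPierceConst_pierceConst hd hnrm hq)
  rw [← hT] at main
  have hmom : ∀ a : Measure (Fin d → ℝ), maxMoment q a ≤ maxMoment q (absSub μ ν) →
      maxMoment q (t⁻¹ • a) ^ (1 / q) ≤ t ^ (-(1 / q)) * maxMoment q (absSub μ ν) ^ (1 / q) := by
    intro a ha
    rw [maxMoment, lintegral_smul_measure, smul_eq_mul, ← maxMoment,
      ENNReal.mul_rpow_of_nonneg _ _ (by positivity), ENNReal.inv_rpow, ← ENNReal.rpow_neg]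
    gcongr
  have hbound : pierceConst nrm 1 q * (maxMoment q (t⁻¹ • p) ^ (1 / q) +
      maxMoment q (t⁻¹ • n) ^ (1 / q)) * t ^ (1 - 1 / (d : ℝ)) ≤ tvBound nrm q μ ν := by
    calc _ ≤ pierceConst nrm 1 q * (t ^ (-(1 / q)) * maxMoment q (absSub μ ν) ^ (1 / q) +
          t ^ (-(1 / q)) * maxMoment q (absSub μ ν) ^ (1 / q)) * t ^ (1 - 1 / (d : ℝ)) := by
          gcongr
          · exact hmom p hmomp
          · exact hmom n hmomn
      _ = 2 * pierceConst nrm 1 q * (t ^ (1 - 1 / (d : ℝ)) * t ^ (-(1 / q))) *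
          maxMoment q (absSub μ ν) ^ (1 / q) := by ring
      _ = 2 * pierceConst nrm 1 q * t ^ (1 - 1 / (d : ℝ) - 1 / q) *
          maxMoment q (absSub μ ν) ^ (1 / q) := by
          rw [← ENNReal.rpow_add _ _ ht0 htt, ← sub_eq_add_neg]
      -- The mass `t` of one difference is estimated by the full total variation, using that the
      -- exponent is positive.
      _ ≤ _ := by
          rw [tvBound]
          gcongr
          exact hpA _
  have hcancel : (N : ℝ≥0∞) ^ (1 / (d : ℝ)) * (N : ℝ≥0∞) ^ (-(1 / (d : ℝ))) = 1 := by
    rw [← ENNReal.rpow_add _ _ hN0 (ENNReal.natCast_ne_top N), add_neg_cancel, ENNReal.rpow_zero]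
  rw [scaledError, scaledError]
  have expand : ∀ a b e f k r v : ℝ≥0∞, a * b = 1 →
      a * (v + (k * r * b * e + f * T)) = a * v + (k * r * e + a * (f * T)) := by
    intro a b e f k r v hab
    have : a * (v + (k * r * b * e + f * T)) = a * v + (a * b * (k * r * e) + a * (f * T)) := by
      ring
    rw [this, hab, one_mul]
  refine (mul_le_mul_right main _).trans ((expand _ _ _ _ _ _ _ hcancel).le.trans ?_)
  exact add_le_add le_rfl (add_le_add hbound le_rfl)

lemma limsup_add_vanishing_le {c : ℕ → ℝ≥0∞} (hc : Tendsto c atTop (𝓝 0)) (B : ℝ≥0∞) :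
    limsup (fun N => B + c N) atTop = B := by
  have : Tendsto (fun N => B + c N) atTop (𝓝 (B + 0)) := tendsto_const_nhds.add hc
  rw [add_zero] at this
  exact this.limsup_eq

/-- The vanishing `c` drops out of both limits, and the constant `B` can be pulled out of them. -/
lemma limsup_tsub_le {u v c : ℕ → ℝ≥0∞} {B : ℝ≥0∞} (hc : Tendsto c atTop (𝓝 0))
    (h : ∀ᶠ N in atTop, u N ≤ v N + (B + c N)) :
    limsup u atTop - limsup v atTop ≤ B ∧ liminf u atTop - liminf v atTop ≤ B := by
  have h' : ∀ᶠ N in atTop, u N ≤ ((fun N => v N + B) + c) N :=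
    h.mono fun N hN => hN.trans_eq (add_assoc _ _ _).symm
  constructor
  · rw [tsub_le_iff_left]
    refine (limsup_le_limsup h').trans (le_of_eq ?_)
    rw [ENNReal.limsup_add_of_right_tendsto_zero hc]
    exact (limsup_add_const atTop v B (by isBoundedDefault) (by isBoundedDefault))
  · rw [tsub_le_iff_left]
    refine (liminf_le_liminf h').trans (le_of_eq ?_)
    rw [ENNReal.liminf_add_of_right_tendsto_zero hc]
    exact (liminf_add_const atTop v B (by isBoundedDefault) (by isBoundedDefault))

end TotalVariation

end RandomQuantization

end

/-! ### The main theorem, by symmetrising the one-sided comparison. -/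

theorem lemma4p6 (d : ℕ) (hd : 3 ≤ d) (nrm : Seminorm ℝ (Fin d → ℝ))
    (hnrm : ∀ x, nrm x = 0 → x = 0) (q : ℝ) (hq : (d : ℝ) / ((d : ℝ) - 1) < q) :
    RandomQuantization.pierceConst nrm 1 q ≠ ∞ ∧
    RandomQuantization.IsPierceConst nrm 1 q (RandomQuantization.pierceConst nrm 1 q) ∧
    (2 < q → RandomQuantization.pierceConst nrm 1 q ≤
      ENNReal.ofReal (RandomQuantization.explicitPierceConst nrm 1 q)) ∧
    ∀ (μ ν : Measure (Fin d → ℝ)) [IsProbabilityMeasure μ] [IsProbabilityMeasure ν],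
      limsup (fun N : ℕ => (N : ℝ≥0∞) ^ (1 / (d : ℝ)) *
          RandomQuantization.absDiff (RandomQuantization.randError nrm 1 N μ)
            (RandomQuantization.randError nrm 1 N ν)) atTop
        ≤ RandomQuantization.tvBound nrm q μ ν ∧
      RandomQuantization.absDiff
          (limsup (RandomQuantization.scaledError nrm μ) atTop)
          (limsup (RandomQuantization.scaledError nrm ν) atTop)
        ≤ RandomQuantization.tvBound nrm q μ ν ∧
      RandomQuantization.absDiff
          (liminf (RandomQuantization.scaledError nrm μ) atTop)
          (liminf (RandomQuantization.scaledError nrm ν) atTop)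
        ≤ RandomQuantization.tvBound nrm q μ ν := by
  open RandomQuantization in
  refine ⟨pierceConst_ne_top hd hnrm hq, isPierceConst_pierceConst hd hnrm hq, fun hq2 =>
    (sInf_le (isPierceConst_shellConst hd hnrm hq)).trans
      (ENNReal.ofReal_le_ofReal (shellConst_le_explicitPierceConst hd hq2)), ?_⟩
  intro μ ν _ _
  obtain ⟨c, hc, h⟩ := RandomQuantization.scaledError_le_add hd hnrm hq μ ν
  obtain ⟨c', hc', h'⟩ := RandomQuantization.scaledError_le_add hd hnrm hq ν μ
  rw [RandomQuantization.tvBound_comm] at h'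
  obtain ⟨h1, h2⟩ := RandomQuantization.limsup_tsub_le hc h
  obtain ⟨h3, h4⟩ := RandomQuantization.limsup_tsub_le hc' h'
  refine ⟨?_, max_le h1 h3, max_le h2 h4⟩
  have hcc : Tendsto (fun N => c N + c' N) atTop (nhds 0) := by
    simpa using hc.add hc'
  -- The sum of the two vanishing terms bounds both one-sided differences at once.
  refine le_trans (limsup_le_limsup ?_)
    (RandomQuantization.limsup_add_vanishing_le hcc _).le
  filter_upwards [h, h', eventually_ge_atTop 1] with N hN hN' hN1
  have hfin := (RandomQuantization.natCast_rpow_ne hN1 (1 / (d : ℝ))).2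
  rw [RandomQuantization.absDiff, mul_max, ENNReal.mul_sub fun _ _ => hfin,
    ENNReal.mul_sub fun _ _ => hfin]
  exact max_le
    ((tsub_le_iff_left.2 hN).trans (by gcongr; exact le_self_add))
    ((tsub_le_iff_left.2 hN').trans (by gcongr; exact le_add_self))
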